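/- **Setting and construction.** Write $\mathbb N=\{1,2,\dots\}$ and let $K$ be a compact metric space. Fix positive even integers $(m_j,n_j)_{j\ge1}$ with $m_1\ge 8$, $m_{j+1}\ge m_j^2$, $n_1\ge m_1^2$, $n_{j+1}\ge(16n_j)^{\log_2 m_{j+1}}$. Fix a countable dense set $\mathcal A\subset C(K)$ (complex scalars) closed under linear combinations with coefficients in $\mathbb Q+i\mathbb Q$, enumerate $\{\phi\in\mathcal A:\|\phi\|_\infty\le1\}$ as $\phi_1,\phi_2,\dots$, put $\mathcal B_n=\{\theta^k\phi_{i_1}\cdots\phi_{i_k}:k\in\mathbb N,\ 0\le\theta\le\frac n{n+1},\ 1\le i_1,\dots,i_k\le n\}$ and let $$\varrho(\kappa,\kappa')=\sum_{n\ge1}2^{-n}\max\{|\phi(\kappa)-\phi(\kappa')|:\phi\in\mathcal B_n\},$$ a metric on $K$ equivalent to the given one. Fix finite sets $K_1\subset K_2\subset\cdots\subset K$ such that every point of $K$ is within $\varrho$-distance $m_n^{-1}2^{-(n+1)}$ of $K_n$. Let $\mathbb D_n=\{\frac{k_1}{2^n}e^{2\pi i k_2/2^n}:k_1,k_2=1,\dots,2^n\}$.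 Intervals are non-empty intervals of integers. Let $\bar\Gamma=\bigcup_n\bar\Delta_n$, where $\bar\Delta_n$ (the elements of rank $n$) and $\bar\Gamma_n=\bar\Delta_1\cup\dots\cup\bar\Delta_n$ are defined inductively. The last coordinate of $\gamma\in\bar\Gamma$ is denoted $\kappa(\gamma)$. $\bar\Delta_1=\{(1,\kappa):\kappa\in K_1\}$, and $\bar\Delta_{n+1}$ consists of * $(n+1,\kappa)$ with $\kappa\in K_{n+1}$ (all elements $(n,\kappa)$, $n\ge 1$, have weight $0$ and undefined age); * $(n+1,I,\eta,\lambda,m_j^{-1},\kappa)$ with $I\subset\{1,\dots,n\}$ an interval, $\eta\in\bar\Gamma_n$, $\lambda\in\mathbb D_{n+1}$, $1\le j\le n+1$, $\kappa\in K_{n+1}$ (weight $m_j^{-1}$, age $1$); * $(n+1,\xi,I,\eta,\lambda,m_j^{-1},\kappa)$ with $\xi\in\bar\Gamma_{n-1}$ of weight $m_j^{-1}$ and age $<n_j$, $I\subset\{\operatorname{rank}(\xi)+1,\dots,n\}$ an interval, and $\eta,\lambda,j,\kappa$ as before (weight $m_j^{-1}$, age $\operatorname{age}(\xi)+1$). Fix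 an injection $\sigma:\bar\Gamma\to\mathbb N$ with $m_{4\sigma(\gamma)}>2^{\operatorname{rank}(\gamma)}$ for all $\gamma$. For an interval $I$ and $\gamma\in\bar\Gamma$ put $\operatorname{weight}(I,\gamma)=0$ if $\operatorname{rank}(\gamma)\le\min I$ and $\operatorname{weight}(I,\gamma)=\operatorname{weight}(\gamma)$ otherwise. Let $\Gamma\subset\bar\Gamma$ consist of all $(n,\kappa)\in\bar\Gamma$ and, inductively on the rank, of those tuples of $\bar\Gamma$ of the second and third kind whose components $\eta$ (and $\xi$) lie in $\Gamma$ and which satisfy: * second kind: $j$ is even, or $j$ is odd and $\operatorname{weight}(\eta)=m_{4i-2}^{-1}$ for some $i\in\mathbb N$; * third kind: $\varrho(\kappa(\xi),\kappa)\le m_j^{-1}2^{-\operatorname{rank}(\xi)}$, $\varrho(\kappa(\eta),\kappa)\le2^{-\operatorname{rank}(\xi)}$, and either $j$ is even and $\operatorname{weight}(I,\eta)\le2^{-\operatorname{rank}(\xi)}$, or $j$ is odd and $\operatorname{weight}(\eta)=m_{4\sigma(\xi)}^{-1}$. Let $\Gamma_n=\{\gamma\in\Gamma:\operatorname{rank}(\gamma)\le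 n\}$ and let $r_n$ denote restriction to $\Gamma_n$. Extension operators $i_{m,n}:\ell_\infty(\Gamma_m)\to\ell_\infty(\Gamma_n)$, $m\le n$, are defined inductively by $i_{n,n}=\mathrm{id}$, $i_{m,n+1}=i_{n,n+1}i_{m,n}$, where $i_{n,n+1}x$ extends $x$ by $(i_{n,n+1}x)(\gamma)=c^*_\gamma(x)$ for $\operatorname{rank}(\gamma)=n+1$. With $P^{(n)}_m=i_{m,n}r_m$, $P^{(n)}_0=0$, $P^{(n)}_{\{a,\dots,b\}}=P^{(n)}_b-P^{(n)}_{a-1}$ and the evaluation functionals $e^*_\gamma$, the functional $c^*_\gamma$ is respectively $0$, $m_j^{-1}\lambda\,e^*_\eta\circ P^{(n)}_I$, or $e^*_\xi+m_j^{-1}\lambda\,e^*_\eta\circ P^{(n)}_I$ for the three kinds of tuples (and $c^*_\gamma=0$ for rank $1$). The operators $i_{m,n}$ are uniformly bounded; let $i_m=\lim_n i_{m,n}:\ell_\infty(\Gamma_m)\to\ell_\infty(\Gamma)$ and let $\mathfrak X_{C(K)}$ be the closure of $\bigcup_m i_m(\ell_\infty(\Gamma_m))$ in $\ell_\infty(\Gamma)$.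 On $\mathfrak X_{C(K)}$ put $P_m=i_mr_m$, $P_0=0$, and $P_I=P_b-P_{a-1}$ for $I=\{a,\dots,b\}$, $P_I=\mathrm{id}-P_{a-1}$ for $I=\{a,a+1,\dots\}$; write $P_{[1,N)}=P_{N-1}$. For $\gamma\in\Gamma$ of rank $n$ let $d_\gamma=i_n(e_\gamma)$ and $d^*_\gamma=e^*_\gamma-c^*_\gamma\circ r_{n-1}$ (just $e^*_\gamma$ for $n=1$); these are biorthogonal systems in $\mathfrak X_{C(K)}$ and its dual. For $\phi:K\to\mathbb C$ let $\hat\phi$ be the linear map on $\langle d_\gamma:\gamma\in\Gamma\rangle$ with $\hat\phi(d_\gamma)=\phi(\kappa(\gamma))d_\gamma$, and also the linear map on $\langle d^*_\gamma:\gamma\in\Gamma\rangle$ with $\hat\phi(d^*_\gamma)=\phi(\kappa(\gamma))d^*_\gamma$. **Proposition.** For all real $L,M\ge0$ there is $N\in\mathbb N$ such that every $\phi:K\to\mathbb C$ that is $L$-Lipschitz with respect to $\varrho$ and satisfies $\|\phi\|_\infty\le M$ has the following properties. 1. For every $\gamma\in\Gamma$ and every (finite or infinite) interval $I$ of $\mathbb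 N$ with $\min I\ge N$, the functional $e^*_\gamma\circ P_I$ lies in $\langle d^*_{\gamma'}:\gamma'\in\Gamma\rangle$ and $$\big\|\hat\phi(e^*_\gamma\circ P_I)-\phi(\kappa(\gamma))\,e^*_\gamma\circ P_I\big\|\le 7\operatorname{weight}(I,\gamma)\,M .$$ 2. $\hat\phi$ extends to a bounded linear operator $\hat\phi:\mathfrak X_{C(K)}\to\mathfrak X_{C(K)}$, and $\|\hat\phi-P_{[1,N)}\hat\phi\|\le4M$. -/

import Mathlib

open scoped ENNReal

noncomputable section

namespace BDCK

universe u

/-! ### Parameters of the construction -/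

/-- The double sequence `(m_j, n_j)`, `j = 1, 2, …` (the values at `j = 0` are never used). -/
structure WeightSeq where
  m : ℕ → ℕ
  n : ℕ → ℕ
  m_pos : ∀ j, 1 ≤ j → 0 < m j
  n_pos : ∀ j, 1 ≤ j → 0 < n j
  m_even : ∀ j, 1 ≤ j → Even (m j)
  n_even : ∀ j, 1 ≤ j → Even (n j)
  m_one : 8 ≤ m 1
  m_succ : ∀ j, 1 ≤ j → m j ^ 2 ≤ m (j + 1)
  n_one : m 1 ^ 2 ≤ n 1
  n_succ : ∀ j, 1 ≤ j → (16 * (n j : ℝ)) ^ Real.logb 2 (m (j + 1)) ≤ (n (j + 1) : ℝ)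

/-- A countable dense set `A ⊆ C(K)` closed under linear combinations with coefficients in
`ℚ + iℚ`, and an enumeration `φ_1, φ_2, …` of its elements of norm at most one. -/
structure DenseFamily (K : Type u) [TopologicalSpace K] [CompactSpace K] where
  A : Set C(K, ℂ)
  countable : A.Countable
  dense : Dense A
  lin_comb : ∀ f ∈ A, ∀ g ∈ A, ∀ p q r s : ℚ,
    ((p : ℂ) + (q : ℂ) * Complex.I) • f + ((r : ℂ) + (s : ℂ) * Complex.I) • g ∈ A
  enum : ℕ → C(K, ℂ)
  enum_image : enum '' Set.Ici 1 = {f | f ∈ A ∧ ‖f‖ ≤ 1}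

/-- The semigroup `B_n` of all `θ^k φ_{i_1} ⋯ φ_{i_k}` with `k ≥ 1`, `0 ≤ θ ≤ n/(n+1)` and
`1 ≤ i_1, …, i_k ≤ n`. -/
def DenseFamily.semigroup {K : Type u} [TopologicalSpace K] [CompactSpace K]
    (F : DenseFamily K) (n : ℕ) : Set C(K, ℂ) :=
  {f | ∃ (k : ℕ) (θ : ℝ) (i : Fin k → ℕ), 1 ≤ k ∧ 0 ≤ θ ∧ θ ≤ (n : ℝ) / (n + 1) ∧
    (∀ s, 1 ≤ i s ∧ i s ≤ n) ∧ f = ((θ : ℂ) ^ k) • ∏ s, F.enum (i s)}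

/-- The metric `ϱ(x, y) = ∑_{n ≥ 1} 2^{-n} max {|f x - f y| : f ∈ B_n}` on `K`. -/
def DenseFamily.metric {K : Type u} [TopologicalSpace K] [CompactSpace K]
    (F : DenseFamily K) (x y : K) : ℝ :=
  ∑' n : ℕ, ((2 : ℝ) ^ (n + 1))⁻¹ * ⨆ f : F.semigroup (n + 1), ‖f.1 x - f.1 y‖

/-- The finite set `𝔻_n = {(k₁/2^n) e^{2πi k₂/2^n} : k₁, k₂ = 1, …, 2^n}`. -/
def discPts (n : ℕ) : Set ℂ :=
  {z | ∃ k₁ k₂ : ℕ, 1 ≤ k₁ ∧ k₁ ≤ 2 ^ n ∧ 1 ≤ k₂ ∧ k₂ ≤ 2 ^ n ∧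
    z = ((k₁ : ℂ) / 2 ^ n) * Complex.exp (Complex.I * ((k₂ : ℂ) / 2 ^ n * (2 * Real.pi)))}

/-! ### The index sets -/

/-- The tuples `(n, κ)`, `(n, I, η, λ, m_j⁻¹, κ)` and `(n, ξ, I, η, λ, m_j⁻¹, κ)`. The (non-empty)
interval `I = {lo, …, hi}` is recorded by its end points and the weight `m_j⁻¹` by `j`
(the sequence `m` is strictly increasing). -/
inductive Node (K : Type u) : Type u
  | base (n : ℕ) (κ : K) : Node K
  | first (n lo hi : ℕ) (η : Node K) (lam : ℂ) (j : ℕ) (κ : K) : Node K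
  | next (n : ℕ) (ξ : Node K) (lo hi : ℕ) (η : Node K) (lam : ℂ) (j : ℕ) (κ : K) : Node K

namespace Node

variable {K : Type u}

def rank : Node K → ℕ
  | base n _ => n
  | first n _ _ _ _ _ _ => n
  | next n _ _ _ _ _ _ _ => n

def kap : Node K → K
  | base _ κ => κ
  | first _ _ _ _ _ _ κ => κ
  | next _ _ _ _ _ _ _ κ => κ

/-- The age, with the value `0` where it is undefined. -/
def age : Node K → ℕ
  | base _ _ => 0
  | first _ _ _ _ _ _ _ => 1
  | next _ ξ _ _ _ _ _ _ => age ξ + 1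

def weight (W : WeightSeq) : Node K → ℝ
  | base _ _ => 0
  | first _ _ _ _ _ j _ => (W.m j : ℝ)⁻¹
  | next _ _ _ _ _ _ j _ => (W.m j : ℝ)⁻¹

/-- `weight(I, γ)` for a non-empty interval `I`: zero if `rank γ ≤ min I`, else `weight γ`. -/
def weightOn (W : WeightSeq) (I : Set ℕ) (γ : Node K) : ℝ :=
  if γ.rank ≤ sInf I then 0 else γ.weight W

end Node

/-- The set `Γ̄`. -/
inductive GammaBar {K : Type u} (W : WeightSeq) (net : ℕ → Finset K) : Node K → Prop
  | base (n : ℕ) (κ : K) : 1 ≤ n → κ ∈ net n → GammaBar W net (.base n κ)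
  | first (n lo hi : ℕ) (η : Node K) (lam : ℂ) (j : ℕ) (κ : K) :
      1 ≤ n → 1 ≤ lo → lo ≤ hi → hi ≤ n →
      GammaBar W net η → η.rank ≤ n →
      lam ∈ discPts (n + 1) → 1 ≤ j → j ≤ n + 1 → κ ∈ net (n + 1) →
      GammaBar W net (.first (n + 1) lo hi η lam j κ)
  | next (n : ℕ) (ξ : Node K) (lo hi : ℕ) (η : Node K) (lam : ℂ) (j : ℕ) (κ : K) :
      1 ≤ n → GammaBar W net ξ → ξ.rank ≤ n - 1 →
      ξ.weight W = (W.m j : ℝ)⁻¹ → ξ.age < W.n j →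
      ξ.rank + 1 ≤ lo → lo ≤ hi → hi ≤ n →
      GammaBar W net η → η.rank ≤ n →
      lam ∈ discPts (n + 1) → 1 ≤ j → j ≤ n + 1 → κ ∈ net (n + 1) →
      GammaBar W net (.next (n + 1) ξ lo hi η lam j κ)

/-- All the choices that are made before the space is constructed: the sequences `(m_j, n_j)`,
the family of functions that defines the metric `ϱ`, the increasing finite nets `K_n` and the
coding function `σ`. -/
structure Choices (K : Type u) [MetricSpace K] [CompactSpace K] where
  W : WeightSeq
  F : DenseFamily K
  net : ℕ → Finset K
  net_mono : ∀ n, 1 ≤ n → net n ⊆ net (n + 1)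
  net_dense : ∀ n, 1 ≤ n → ∀ x : K, ∃ y ∈ net n,
    F.metric x y ≤ (W.m n : ℝ)⁻¹ * ((2 : ℝ) ^ (n + 1))⁻¹
  code : Node K → ℕ
  code_pos : ∀ γ, GammaBar W net γ → 1 ≤ code γ
  code_inj : Set.InjOn code {γ | GammaBar W net γ}
  code_large : ∀ γ, GammaBar W net γ → 2 ^ γ.rank < W.m (4 * code γ)

variable {K : Type u} [MetricSpace K] [CompactSpace K]

/-- The subset `Γ` of `Γ̄`. -/
inductive Gamma (C : Choices K) : Node K → Prop
  | base (n : ℕ) (κ : K) :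
      GammaBar C.W C.net (.base n κ) → Gamma C (.base n κ)
  | firstEven (n lo hi : ℕ) (η : Node K) (lam : ℂ) (j : ℕ) (κ : K) :
      GammaBar C.W C.net (.first n lo hi η lam j κ) → Even j → Gamma C η →
      Gamma C (.first n lo hi η lam j κ)
  | firstOdd (n lo hi : ℕ) (η : Node K) (lam : ℂ) (j : ℕ) (κ : K) :
      GammaBar C.W C.net (.first n lo hi η lam j κ) → Odd j → Gamma C η →
      (∃ i, 1 ≤ i ∧ η.weight C.W = (C.W.m (4 * i - 2) : ℝ)⁻¹) →
      Gamma C (.first n lo hi η lam j κ)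
  | nextEven (n : ℕ) (ξ : Node K) (lo hi : ℕ) (η : Node K) (lam : ℂ) (j : ℕ) (κ : K) :
      GammaBar C.W C.net (.next n ξ lo hi η lam j κ) → Even j → Gamma C ξ → Gamma C η →
      η.weightOn C.W (Set.Icc lo hi) ≤ ((2 : ℝ) ^ ξ.rank)⁻¹ →
      C.F.metric ξ.kap κ ≤ (C.W.m j : ℝ)⁻¹ * ((2 : ℝ) ^ ξ.rank)⁻¹ →
      C.F.metric η.kap κ ≤ ((2 : ℝ) ^ ξ.rank)⁻¹ →
      Gamma C (.next n ξ lo hi η lam j κ)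
  | nextOdd (n : ℕ) (ξ : Node K) (lo hi : ℕ) (η : Node K) (lam : ℂ) (j : ℕ) (κ : K) :
      GammaBar C.W C.net (.next n ξ lo hi η lam j κ) → Odd j → Gamma C ξ → Gamma C η →
      η.weight C.W = (C.W.m (4 * C.code ξ) : ℝ)⁻¹ →
      C.F.metric ξ.kap κ ≤ (C.W.m j : ℝ)⁻¹ * ((2 : ℝ) ^ ξ.rank)⁻¹ →
      C.F.metric η.kap κ ≤ ((2 : ℝ) ^ ξ.rank)⁻¹ →
      Gamma C (.next n ξ lo hi η lam j κ)

/-- `Γ` as a type. -/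
abbrev Idx (C : Choices K) : Type u := {γ : Node K // Gamma C γ}

/-! ### Extension functionals and extension operators

Functions on `Γ_n` (nodes of rank at most `n`) are regarded as functions on all nodes that vanish
at nodes of larger rank. The values at the nodes of `Γ` only involve values at nodes of `Γ`. -/

section Extension

variable {K : Type u}

/-- Restriction `r_n` to the nodes of rank at most `n`, followed by extension by zero. -/
def trunc (n : ℕ) : (Node K → ℂ) →ₗ[ℂ] (Node K → ℂ) :=
  LinearMap.pi fun γ => if γ.rank ≤ n then LinearMap.proj γ else 0

/-- The extension functional `c_γ^*` of a node of rank `n + 1`, given the projections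
`P m = P_m^{(n)}`: it is `0`, `m_j⁻¹ λ e_η^* ∘ P_I^{(n)}` or `e_ξ^* + m_j⁻¹ λ e_η^* ∘ P_I^{(n)}`,
where `P_I^{(n)} = P_hi^{(n)} - P_{lo-1}^{(n)}` for `I = {lo, …, hi}`. -/
def extFunctional (W : WeightSeq) (P : ℕ → (Node K → ℂ) →ₗ[ℂ] (Node K → ℂ)) :
    Node K → ((Node K → ℂ) →ₗ[ℂ] ℂ)
  | .base _ _ => 0
  | .first _ lo hi η lam j _ =>
      (((W.m j : ℂ)⁻¹ * lam) • (LinearMap.proj η ∘ₗ (P hi - P (lo - 1))))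
  | .next _ ξ lo hi η lam j _ =>
      LinearMap.proj ξ + (((W.m j : ℂ)⁻¹ * lam) • (LinearMap.proj η ∘ₗ (P hi - P (lo - 1))))

/-- The extension operator `i_{n,n+1}`, given the projections `P m = P_m^{(n)}`. -/
def stepExt (W : WeightSeq) (P : ℕ → (Node K → ℂ) →ₗ[ℂ] (Node K → ℂ)) (n : ℕ) :
    (Node K → ℂ) →ₗ[ℂ] (Node K → ℂ) :=
  LinearMap.pi fun γ => if γ.rank = n + 1 then extFunctional W P γ else LinearMap.proj γ

/-- `finProj W n m` is the projection `P_m^{(n)} = i_{m,n} r_m` on the functions on `Γ_n`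
(the identity of the functions on `Γ_n` if `m ≥ n`), where
`i_{m,n+1} = i_{n,n+1} ∘ i_{m,n}`. -/
def finProj (W : WeightSeq) : ℕ → ℕ → (Node K → ℂ) →ₗ[ℂ] (Node K → ℂ)
  | 0, _ => trunc 0
  | n + 1, m =>
      if n + 1 ≤ m then trunc (n + 1) else stepExt W (finProj W n) n ∘ₗ finProj W n m

/-- `i_m r_m`, where `i_m = lim_n i_{m,n}`: the value at `γ` of `i_{m,n} x` is the same for all
`n ≥ max m (rank γ)`. -/
def extAll (W : WeightSeq) (m : ℕ) : (Node K → ℂ) →ₗ[ℂ] (Node K → ℂ) :=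
  LinearMap.pi fun γ => LinearMap.proj γ ∘ₗ finProj W (max m γ.rank) m

/-- The functional `c_γ^* ∘ r_n`, where `rank γ = n + 1`. -/
def cFun (W : WeightSeq) (γ : Node K) : (Node K → ℂ) →ₗ[ℂ] ℂ :=
  extFunctional W (finProj W (γ.rank - 1)) γ

theorem trunc_apply (n : ℕ) (x : Node K → ℂ) (γ : Node K) :
    trunc n x γ = if γ.rank ≤ n then x γ else 0 := by
  simp only [trunc, LinearMap.pi_apply]
  split_ifs <;> simp

theorem stepExt_apply (W : WeightSeq) (P : ℕ → (Node K → ℂ) →ₗ[ℂ] (Node K → ℂ)) (n : ℕ)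
    (x : Node K → ℂ) (γ : Node K) :
    stepExt W P n x γ = if γ.rank = n + 1 then extFunctional W P γ x else x γ := by
  simp only [stepExt, LinearMap.pi_apply]
  split_ifs <;> simp

theorem finProj_of_le (W : WeightSeq) {n m : ℕ} (h : n ≤ m) :
    (finProj W n m : (Node K → ℂ) →ₗ[ℂ] (Node K → ℂ)) = trunc n := by
  cases n with
  | zero => rfl
  | succ n => simp [finProj, h]

theorem finProj_succ_of_lt (W : WeightSeq) {n m : ℕ} (h : m < n + 1) (x : Node K → ℂ) :
    finProj W (n + 1) m x = stepExt W (finProj W n) n (finProj W n m x) := by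
  simp [finProj, not_le.2 h]

theorem finProj_succ_low (W : WeightSeq) {n : ℕ} (m : ℕ) (x : Node K → ℂ) {γ : Node K}
    (hγ : γ.rank ≤ n) : finProj W (n + 1) m x γ = finProj W n m x γ := by
  rcases le_or_gt (n + 1) m with h | h
  · rw [finProj_of_le W h, finProj_of_le W (by omega : n ≤ m), trunc_apply, trunc_apply,
      if_pos hγ, if_pos (by omega)]
  · rw [finProj_succ_of_lt W h, stepExt_apply, if_neg (by omega)]

theorem finProj_stable (W : WeightSeq) {n n' : ℕ} (m : ℕ) (x : Node K → ℂ) {γ : Node K}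
    (hγ : γ.rank ≤ n) (h : n ≤ n') : finProj W n' m x γ = finProj W n m x γ := by
  induction n', h using Nat.le_induction with
  | base => rfl
  | succ k hk ih => rw [finProj_succ_low W m x (by omega), ih]

theorem finProj_high (W : WeightSeq) {n : ℕ} (m : ℕ) (x : Node K → ℂ) {γ : Node K}
    (hγ : n < γ.rank) : finProj W n m x γ = 0 := by
  induction n with
  | zero => rw [finProj_of_le W (Nat.zero_le m), trunc_apply, if_neg (by omega)]
  | succ n ih =>
    rcases le_or_gt (n + 1) m with h | h
    · rw [finProj_of_le W h, trunc_apply, if_neg (by omega)]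
    · rw [finProj_succ_of_lt W h, stepExt_apply, if_neg (by omega), ih (by omega)]

theorem finProj_fix (W : WeightSeq) {n m : ℕ} (x : Node K → ℂ) {γ : Node K}
    (hn : γ.rank ≤ n) (hm : γ.rank ≤ m) : finProj W n m x γ = x γ := by
  rw [finProj_stable W m x le_rfl hn, finProj_of_le W hm, trunc_apply, if_pos le_rfl]

theorem finProj_top (W : WeightSeq) {n m : ℕ} (h : m < n + 1) (x : Node K → ℂ) {γ : Node K}
    (hγ : γ.rank = n + 1) :
    finProj W (n + 1) m x γ = extFunctional W (finProj W n) γ (finProj W n m x) := by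
  rw [finProj_succ_of_lt W h, stepExt_apply, if_pos hγ]

theorem finProj_congr (W : WeightSeq) (n m : ℕ) {x y : Node K → ℂ}
    (h : ∀ γ : Node K, γ.rank ≤ n → γ.rank ≤ m → x γ = y γ) :
    finProj W n m x = finProj W n m y := by
  induction n with
  | zero =>
    ext γ
    rw [finProj_of_le W (Nat.zero_le m), trunc_apply, trunc_apply]
    split_ifs with h0
    · exact h γ h0 (by omega)
    · rfl
  | succ n ih =>
    rcases le_or_gt (n + 1) m with hm | hm
    · ext γ
      rw [finProj_of_le W hm, trunc_apply, trunc_apply]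
      split_ifs with h0
      · exact h γ h0 (by omega)
      · rfl
    · rw [finProj_succ_of_lt W hm, finProj_succ_of_lt W hm,
        ih fun γ h1 h2 => h γ (by omega) h2]

theorem finProj_comp (W : WeightSeq) (n a m : ℕ) (x : Node K → ℂ) :
    finProj W n a (finProj W n m x) = finProj W n (min a m) x := by
  induction n with
  | zero =>
    ext γ
    simp only [finProj_of_le W (Nat.zero_le _), trunc_apply]
    split_ifs <;> rfl
  | succ n ih =>
    have key : finProj W n a (finProj W (n + 1) m x) = finProj W n (min a m) x := by
      rw [← ih]
      exact finProj_congr W n a fun γ h1 _ => finProj_succ_low W m x h1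
    ext γ
    rcases lt_trichotomy γ.rank (n + 1) with h | h | h
    · rw [finProj_succ_low W _ _ (by omega), finProj_succ_low W _ _ (by omega), key]
    · rcases le_or_gt (n + 1) a with ha | ha
      · rw [finProj_fix W _ h.le (by omega)]
        rcases le_or_gt (n + 1) m with hm | hm
        · rw [finProj_fix W _ h.le (by omega), finProj_fix W _ h.le (by omega)]
        · rw [min_eq_right (by omega)]
      · rw [finProj_top W ha _ h, finProj_top W (by omega) _ h, key]
    · rw [finProj_high W _ _ h, finProj_high W _ _ h]

end Extension

/-! ### Uniform boundedness of the extension operators -/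

theorem WeightSeq.eight_le (W : WeightSeq) {j : ℕ} (hj : 1 ≤ j) : 8 ≤ W.m j := by
  induction j, hj using Nat.le_induction with
  | base => exact W.m_one
  | succ k hk ih =>
    have := W.m_succ k hk
    nlinarith

theorem norm_le_one_of_mem_discPts {n : ℕ} {z : ℂ} (hz : z ∈ discPts n) : ‖z‖ ≤ 1 := by
  obtain ⟨k₁, k₂, -, h1, -, -, rfl⟩ := hz
  have h2 : ‖Complex.exp (Complex.I * ((k₂ : ℂ) / 2 ^ n * (2 * Real.pi)))‖ = 1 := by
    have := Complex.norm_exp_ofReal_mul_I ((k₂ : ℝ) / 2 ^ n * (2 * Real.pi))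
    rw [← this]
    congr 2
    push_cast
    ring
  rw [norm_mul, h2, mul_one, norm_div, norm_pow, Complex.norm_natCast]
  have h3 : ‖(2 : ℂ)‖ = 2 := by simp
  rw [h3, div_le_one (by positivity)]
  exact_mod_cast h1

theorem norm_coef_le (W : WeightSeq) {j n : ℕ} (hj : 1 ≤ j) {z : ℂ} (hz : z ∈ discPts n) :
    ‖(W.m j : ℂ)⁻¹ * z‖ ≤ 1 / 8 := by
  have h1 := norm_le_one_of_mem_discPts hz
  have h2 : (8 : ℝ) ≤ W.m j := by exact_mod_cast W.eight_le hj
  rw [norm_mul, norm_inv, Complex.norm_natCast]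
  have h3 : (W.m j : ℝ)⁻¹ ≤ 1 / 8 := by
    rw [one_div]
    exact inv_anti₀ (by norm_num) h2
  calc (W.m j : ℝ)⁻¹ * ‖z‖ ≤ 1 / 8 * 1 := by gcongr
    _ = 1 / 8 := by norm_num

theorem Gamma.bar {C : Choices K} {γ : Node K} (h : Gamma C γ) : GammaBar C.W C.net γ := by
  cases h <;> assumption

theorem Gamma.one_le_rank {C : Choices K} {γ : Node K} (h : Gamma C γ) : 1 ≤ γ.rank := by
  have := h.bar
  cases this <;> simp only [Node.rank] <;> omega

theorem norm_comp_diff_le {p q c : ℂ} {B : ℝ} (hc : ‖c‖ ≤ 1 / 8) (hp : ‖p‖ ≤ 4 / 3 * B)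
    (hq : ‖q‖ ≤ 4 / 3 * B) : ‖c * (p - q)‖ ≤ 1 / 3 * B := by
  have h := norm_sub_le p q
  rw [norm_mul]
  calc ‖c‖ * ‖p - q‖ ≤ 1 / 8 * (4 / 3 * B + 4 / 3 * B) := by
        gcongr
        linarith
    _ = 1 / 3 * B := by ring

theorem norm_finProj_le (C : Choices K) {x : Node K → ℂ} {B : ℝ} (hx : ∀ γ, ‖x γ‖ ≤ B)
    (n m : ℕ) {γ : Node K} (hγ : Gamma C γ) : ‖finProj C.W n m x γ‖ ≤ 4 / 3 * B := by
  have hB : 0 ≤ B := (norm_nonneg _).trans (hx γ)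
  induction n generalizing m γ with
  | zero =>
    rw [finProj_high C.W m x hγ.one_le_rank, norm_zero]
    positivity
  | succ n ih =>
    rcases lt_trichotomy γ.rank (n + 1) with h | h | h
    · rw [finProj_succ_low C.W m x (by omega)]
      exact ih m hγ
    · rcases le_or_gt (n + 1) m with hm | hm
      · rw [finProj_fix C.W x h.le (by omega)]
        linarith [hx γ]
      · rw [finProj_top C.W hm x h]
        have main : ∀ (lo hi : ℕ) (η : Node K) (c : ℂ), Gamma C η → ‖c‖ ≤ 1 / 8 →
            ‖c * (finProj C.W n hi (finProj C.W n m x) η -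
              finProj C.W n (lo - 1) (finProj C.W n m x) η)‖ ≤ 1 / 3 * B := by
          intro lo hi η c hη hc
          rw [finProj_comp, finProj_comp]
          exact norm_comp_diff_le hc (ih _ hη) (ih _ hη)
        have nextCase : ∀ (lo hi : ℕ) (ξ η : Node K) (c : ℂ), Gamma C ξ → Gamma C η →
            ‖c‖ ≤ 1 / 8 → ξ.rank + 1 ≤ lo → lo ≤ hi → ξ.rank ≤ n →
            ‖finProj C.W n m x ξ + c * (finProj C.W n hi (finProj C.W n m x) η -
              finProj C.W n (lo - 1) (finProj C.W n m x) η)‖ ≤ 4 / 3 * B := by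
          intro lo hi ξ η c hξ hη hc h1 h2 h3
          rcases le_or_gt ξ.rank m with h4 | h4
          · have h5 := main lo hi η c hη hc
            rw [finProj_fix C.W x h3 h4]
            refine (norm_add_le _ _).trans ?_
            linarith [hx ξ]
          · rw [finProj_comp, finProj_comp, min_eq_right (by omega), min_eq_right (by omega),
              sub_self, mul_zero, add_zero]
            exact ih m hξ
        cases hγ with
        | base _ _ _ =>
          simp only [extFunctional, LinearMap.zero_apply, norm_zero]
          positivity
        | firstEven _ lo hi η lam j κ hb _ hη =>
          cases hb with
          | first _ _ _ _ _ _ _ _ _ _ _ _ _ hl hj =>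
            have := main lo hi η _ hη (norm_coef_le C.W hj hl)
            simp only [extFunctional, LinearMap.smul_apply, LinearMap.comp_apply,
              LinearMap.sub_apply, LinearMap.proj_apply, Pi.sub_apply, smul_eq_mul]
            linarith
        | firstOdd _ lo hi η lam j κ hb _ hη =>
          cases hb with
          | first _ _ _ _ _ _ _ _ _ _ _ _ _ hl hj =>
            have := main lo hi η _ hη (norm_coef_le C.W hj hl)
            simp only [extFunctional, LinearMap.smul_apply, LinearMap.comp_apply,
              LinearMap.sub_apply, LinearMap.proj_apply, Pi.sub_apply, smul_eq_mul]
            linarith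
        | nextEven _ ξ lo hi η lam j κ hb _ hξ hη =>
          cases hb with
          | next _ _ _ _ _ _ _ _ _ _ hr _ _ hlo hle _ _ _ hl hj =>
            exact nextCase lo hi ξ η _ hξ hη (norm_coef_le C.W hj hl) hlo hle
              (by rw [Node.rank.eq_3] at h; omega)
        | nextOdd _ ξ lo hi η lam j κ hb _ hξ hη =>
          cases hb with
          | next _ _ _ _ _ _ _ _ _ _ hr _ _ hlo hle _ _ _ hl hj =>
            exact nextCase lo hi ξ η _ hξ hη (norm_coef_le C.W hj hl) hlo hle
              (by rw [Node.rank.eq_3] at h; omega)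
    · rw [finProj_high C.W m x h, norm_zero]
      positivity

theorem norm_cFun_le (C : Choices K) {x : Node K → ℂ} {B : ℝ} (hx : ∀ γ, ‖x γ‖ ≤ B)
    {γ : Node K} (hγ : Gamma C γ) : ‖cFun C.W γ x‖ ≤ 4 / 3 * B := by
  have hB : 0 ≤ B := (norm_nonneg _).trans (hx γ)
  have main : ∀ (n lo hi : ℕ) (η : Node K) (c : ℂ), Gamma C η → ‖c‖ ≤ 1 / 8 →
      ‖c * (finProj C.W n hi x η - finProj C.W n (lo - 1) x η)‖ ≤ 1 / 3 * B :=
    fun n lo hi η c hη hc =>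
      norm_comp_diff_le hc (norm_finProj_le C hx _ _ hη) (norm_finProj_le C hx _ _ hη)
  have nextCase : ∀ (n lo hi : ℕ) (ξ η : Node K) (c : ℂ), Gamma C η → ‖c‖ ≤ 1 / 8 →
      ‖x ξ + c * (finProj C.W n hi x η - finProj C.W n (lo - 1) x η)‖ ≤ 4 / 3 * B := by
    intro n lo hi ξ η c hη hc
    refine (norm_add_le _ _).trans ?_
    linarith [hx ξ, main n lo hi η c hη hc]
  cases hγ with
  | base _ _ _ =>
    simp only [cFun, extFunctional, LinearMap.zero_apply, norm_zero]
    positivity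
  | firstEven n lo hi η lam j κ hb _ hη =>
    cases hb with
    | first n _ _ _ _ _ _ _ _ _ _ _ _ hl hj =>
      have := main n lo hi η _ hη (norm_coef_le C.W hj hl)
      simp only [cFun, Node.rank, Nat.add_sub_cancel, extFunctional, LinearMap.smul_apply,
        LinearMap.comp_apply, LinearMap.sub_apply, LinearMap.proj_apply, Pi.sub_apply, smul_eq_mul]
      linarith
  | firstOdd n lo hi η lam j κ hb _ hη =>
    cases hb with
    | first n _ _ _ _ _ _ _ _ _ _ _ _ hl hj =>
      have := main n lo hi η _ hη (norm_coef_le C.W hj hl)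
      simp only [cFun, Node.rank, Nat.add_sub_cancel, extFunctional, LinearMap.smul_apply,
        LinearMap.comp_apply, LinearMap.sub_apply, LinearMap.proj_apply, Pi.sub_apply, smul_eq_mul]
      linarith
  | nextEven n ξ lo hi η lam j κ hb _ hξ hη =>
    cases hb with
    | next n _ _ _ _ _ _ _ _ _ _ _ _ _ _ _ _ _ hl hj =>
      exact nextCase n lo hi ξ η _ hη (norm_coef_le C.W hj hl)
  | nextOdd n ξ lo hi η lam j κ hb _ hξ hη =>
    cases hb with
    | next n _ _ _ _ _ _ _ _ _ _ _ _ _ _ _ _ _ hl hj =>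
      exact nextCase n lo hi ξ η _ hη (norm_coef_le C.W hj hl)

/-! ### The space and its projections -/

/-- The space `ℓ_∞(Γ)`. -/
abbrev Linf (C : Choices K) : Type u := lp (fun _ : Idx C => ℂ) ∞

/-- A function on `Γ`, as a function on all nodes vanishing off `Γ`. -/
def lift (C : Choices K) : Linf C →ₗ[ℂ] (Node K → ℂ) where
  toFun x := Function.extend Subtype.val (x : Idx C → ℂ) 0
  map_add' x y := by
    have := Function.extend_add (Subtype.val : Idx C → Node K) (x : Idx C → ℂ) (y : Idx C → ℂ)
      (0 : Node K → ℂ) 0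
    rw [add_zero] at this
    exact this
  map_smul' c x := by
    have := Function.extend_smul c (Subtype.val : Idx C → Node K) (x : Idx C → ℂ)
      (0 : Node K → ℂ)
    rw [smul_zero] at this
    exact this

theorem lift_apply (C : Choices K) (x : Linf C) (γ : Idx C) : lift C x γ.1 = x γ :=
  Subtype.val_injective.extend_apply _ _ _

theorem norm_lift_le (C : Choices K) (x : Linf C) (γ : Node K) : ‖lift C x γ‖ ≤ ‖x‖ := by
  by_cases h : Gamma C γ
  · rw [lift_apply C x ⟨γ, h⟩]
    exact lp.norm_apply_le_norm (by simp) x _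
  · have : lift C x γ = 0 :=
      Function.extend_apply' _ _ _ (by rintro ⟨a, rfl⟩; exact h a.2)
    rw [this, norm_zero]
    exact norm_nonneg x

/-- The bounded operator `i_m r_m` on `ℓ_∞(Γ)`. -/
def extOp (C : Choices K) (m : ℕ) : Linf C →L[ℂ] Linf C :=
  LinearMap.mkContinuous
    { toFun := fun x => ⟨fun γ => extAll C.W m (lift C x) γ.1, memℓp_infty ⟨4 / 3 * ‖x‖, by
        rintro _ ⟨γ, rfl⟩
        exact norm_finProj_le C (norm_lift_le C x) _ _ γ.2⟩⟩
      map_add' := fun x y => by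
        ext γ
        simp only [map_add]
        rfl
      map_smul' := fun c x => by
        ext γ
        simp only [map_smul]
        rfl } (4 / 3) (fun x => lp.norm_le_of_forall_le (by positivity)
          (fun γ => norm_finProj_le C (norm_lift_le C x) _ _ γ.2))

/-- The subspace `Y_n = i_n(ℓ_∞(Γ_n))`. -/
def levelSpace (C : Choices K) (n : ℕ) : Submodule ℂ (Linf C) :=
  LinearMap.range (extOp C n : Linf C →ₗ[ℂ] Linf C)

/-- The Bourgain-Delbaen space: the closure of the union of the increasing sequence `Y_n` in
`ℓ_∞(Γ)`, with the supremum norm. -/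
def space (C : Choices K) : Submodule ℂ (Linf C) :=
  (⨆ n, levelSpace C n).topologicalClosure

theorem extOp_mem (C : Choices K) (n : ℕ) (x : Linf C) : extOp C n x ∈ space C :=
  Submodule.le_topologicalClosure _ (Submodule.mem_iSup_of_mem n ⟨x, rfl⟩)

/-- The projection `P_n = i_n r_n` of the space onto `Y_n`; `P_0 = 0`. -/
def proj (C : Choices K) (n : ℕ) : space C →L[ℂ] space C :=
  (extOp C n ∘L (space C).subtypeL).codRestrict (space C) fun x => extOp_mem C n x

open Classical in
/-- The projection `P_I` of an interval `I` of `{1, 2, …}`: it is `P_b - P_{a-1}` if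
`I = {a, …, b}` and `id - P_{a-1}` if `I = {a, a + 1, …}`. -/
def projOn (C : Choices K) (I : Set ℕ) : space C →L[ℂ] space C :=
  (if BddAbove I then proj C (sSup I) else ContinuousLinearMap.id ℂ (space C)) -
    proj C (sInf I - 1)

open Classical in
/-- The basis vector `d_γ = i_n(e_γ)`, where `n = rank γ`. -/
def dVec (C : Choices K) (γ : Idx C) : space C :=
  ⟨extOp C γ.1.rank (lp.single ∞ γ 1), extOp_mem C _ _⟩

/-- The evaluation functional `e_γ^*`. -/
def eStar (C : Choices K) (γ : Idx C) : space C →L[ℂ] ℂ :=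
  LinearMap.mkContinuous
    { toFun := fun x => x.1 γ
      map_add' := fun x y => rfl
      map_smul' := fun c x => rfl } 1 (fun x => by
        rw [one_mul]
        exact lp.norm_apply_le_norm (by simp) x.1 γ)

/-- The extension functional `c_γ^*`, as a functional on the space. -/
def cStar (C : Choices K) (γ : Idx C) : space C →L[ℂ] ℂ :=
  LinearMap.mkContinuous (cFun C.W γ.1 ∘ₗ lift C ∘ₗ (space C).subtype) (4 / 3)
    (fun x => norm_cFun_le C (norm_lift_le C x.1) γ.2)

/-- The coordinate functional `d_γ^* = e_γ^* - c_γ^*`. -/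
def dStar (C : Choices K) (γ : Idx C) : space C →L[ℂ] ℂ := eStar C γ - cStar C γ

/-! ### Biorthogonality and diagonal operators -/

theorem extOp_apply (C : Choices K) (m : ℕ) (x : Linf C) (γ : Idx C) :
    extOp C m x γ = finProj C.W (max m γ.1.rank) m (lift C x) γ.1 := rfl

open Classical in
theorem lift_single (C : Choices K) (γ : Idx C) (δ : Node K) :
    lift C (lp.single ∞ γ 1) δ = if δ = γ.1 then 1 else 0 := by
  by_cases h : Gamma C δ
  · rw [lift_apply C _ ⟨δ, h⟩, lp.single_apply, Pi.single_apply]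
    simp [Subtype.ext_iff]
  · have : lift C (lp.single ∞ γ (1 : ℂ)) δ = 0 :=
      Function.extend_apply' _ _ _ (by rintro ⟨a, rfl⟩; exact h a.2)
    rw [this, if_neg]
    rintro rfl
    exact h γ.2

theorem extFunctional_congr {C : Choices K} {P : ℕ → (Node K → ℂ) →ₗ[ℂ] (Node K → ℂ)}
    {x y : Node K → ℂ} {γ : Node K} (hγ : Gamma C γ)
    (h : ∀ δ, Gamma C δ → δ.rank < γ.rank → x δ = y δ)
    (hP : ∀ a δ, Gamma C δ → P a x δ = P a y δ) :
    extFunctional C.W P γ x = extFunctional C.W P γ y := by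
  have hb := hγ.bar
  cases hγ with
  | base => rfl
  | firstEven _ _ _ _ _ _ _ _ _ hη =>
    simp only [extFunctional, LinearMap.smul_apply, LinearMap.comp_apply,
      LinearMap.sub_apply, LinearMap.proj_apply, Pi.sub_apply, hP _ _ hη]
  | firstOdd _ _ _ _ _ _ _ _ _ hη =>
    simp only [extFunctional, LinearMap.smul_apply, LinearMap.comp_apply,
      LinearMap.sub_apply, LinearMap.proj_apply, Pi.sub_apply, hP _ _ hη]
  | nextEven _ ξ _ _ _ _ _ _ _ _ hξ hη =>
    have h4 : x ξ = y ξ := h ξ hξ (by cases hb; rw [Node.rank.eq_3]; omega)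
    simp only [extFunctional, LinearMap.smul_apply, LinearMap.comp_apply,
      LinearMap.add_apply, LinearMap.sub_apply, LinearMap.proj_apply, Pi.sub_apply, hP _ _ hη, h4]
  | nextOdd _ ξ _ _ _ _ _ _ _ _ hξ hη =>
    have h4 : x ξ = y ξ := h ξ hξ (by cases hb; rw [Node.rank.eq_3]; omega)
    simp only [extFunctional, LinearMap.smul_apply, LinearMap.comp_apply,
      LinearMap.add_apply, LinearMap.sub_apply, LinearMap.proj_apply, Pi.sub_apply, hP _ _ hη, h4]

theorem finProj_congr_Gamma {C : Choices K} (n m : ℕ) {x y : Node K → ℂ}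
    (h : ∀ δ, Gamma C δ → δ.rank ≤ n → δ.rank ≤ m → x δ = y δ) {γ : Node K} (hγ : Gamma C γ) :
    finProj C.W n m x γ = finProj C.W n m y γ := by
  induction n generalizing m x y γ with
  | zero => rw [finProj_high C.W m x hγ.one_le_rank, finProj_high C.W m y hγ.one_le_rank]
  | succ n ih =>
    have ih' : ∀ δ, Gamma C δ → finProj C.W n m x δ = finProj C.W n m y δ :=
      fun δ hδ => ih m (fun ε hε h1 h2 => h ε hε (by omega) h2) hδ
    rcases lt_trichotomy γ.rank (n + 1) with hr | hr | hr
    · rw [finProj_succ_low C.W m x (by omega), finProj_succ_low C.W m y (by omega), ih' γ hγ]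
    · rcases le_or_gt (n + 1) m with hm | hm
      · rw [finProj_fix C.W x hr.le (by omega), finProj_fix C.W y hr.le (by omega)]
        exact h γ hγ hr.le (by omega)
      · rw [finProj_top C.W hm x hr, finProj_top C.W hm y hr]
        exact extFunctional_congr hγ (fun δ hδ _ => ih' δ hδ)
          (fun a δ hδ => ih a (fun ε hε _ _ => ih' ε hε) hδ)
    · rw [finProj_high C.W m x hr, finProj_high C.W m y hr]

theorem cFun_congr {C : Choices K} {x y : Node K → ℂ} {γ : Node K} (hγ : Gamma C γ)
    (h : ∀ δ, Gamma C δ → δ.rank < γ.rank → x δ = y δ) : cFun C.W γ x = cFun C.W γ y :=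
  extFunctional_congr hγ h fun a δ hδ => finProj_congr_Gamma _ a
    (fun ε hε h1 _ => h ε hε (by have := hγ.one_le_rank; omega)) hδ

theorem dStar_dVec (C : Choices K) (γ δ : Idx C) [Decidable (γ = δ)] :
    dStar C γ (dVec C δ) = if γ = δ then 1 else 0 := by
  classical
  have h0 : dStar C γ (dVec C δ) = extOp C δ.1.rank (lp.single ∞ δ 1) γ -
      cFun C.W γ.1 (lift C (extOp C δ.1.rank (lp.single ∞ δ 1))) := rfl
  rw [h0, extOp_apply]
  have hr := γ.2.one_le_rank
  rcases le_or_gt γ.1.rank δ.1.rank with h | h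
  · have h1 : cFun C.W γ.1 (lift C (extOp C δ.1.rank (lp.single ∞ δ 1))) = 0 := by
      rw [← map_zero (cFun C.W γ.1)]
      refine cFun_congr γ.2 fun ε hε hlt => ?_
      rw [lift_apply C _ ⟨ε, hε⟩, extOp_apply, finProj_fix C.W _ (by simp) (by simp; omega),
        lift_single, if_neg]
      · rfl
      · rintro rfl
        omega
    rw [h1, finProj_fix C.W _ (by simp) h, lift_single, sub_zero]
    simp [Subtype.ext_iff]
  · have hne : γ ≠ δ := by
      rintro rfl
      omega
    obtain ⟨n, hn⟩ : ∃ n, γ.1.rank = n + 1 := ⟨γ.1.rank - 1, by omega⟩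
    rw [if_neg hne, max_eq_right h.le, hn, finProj_top C.W (by omega) _ hn, sub_eq_zero]
    have h2 : cFun C.W γ.1 = extFunctional C.W (finProj C.W n) γ.1 := by
      rw [cFun, hn, Nat.add_sub_cancel]
    rw [← h2]
    refine cFun_congr γ.2 fun ε hε hlt => ?_
    rw [lift_apply C _ ⟨ε, hε⟩, extOp_apply]
    rcases le_total δ.1.rank ε.rank with h3 | h3
    · rw [max_eq_right h3]
      exact finProj_stable C.W _ _ le_rfl (by omega)
    · rw [max_eq_left h3]
      exact finProj_stable C.W _ _ h3 (by omega)

theorem dVec_linearIndependent (C : Choices K) : LinearIndependent ℂ (dVec C) := by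
  classical
  rw [linearIndependent_iff']
  intro s g hg γ hγ
  have h := congrArg (dStar C γ : space C →ₗ[ℂ] ℂ) hg
  rw [map_sum, map_zero] at h
  rw [← h, Finset.sum_eq_single γ]
  · rw [map_smul, ContinuousLinearMap.coe_coe, dStar_dVec, if_pos rfl, smul_eq_mul, mul_one]
  · intro δ _ hne
    rw [map_smul, ContinuousLinearMap.coe_coe, dStar_dVec, if_neg hne.symm, smul_zero]
  · exact fun h' => absurd hγ h'

theorem dStar_linearIndependent (C : Choices K) : LinearIndependent ℂ (dStar C) := by
  classical
  rw [linearIndependent_iff']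
  intro s g hg γ hγ
  have h := congrArg (fun f : space C →L[ℂ] ℂ => f (dVec C γ)) hg
  simp only [sum_apply, smul_apply, zero_apply,
    dStar_dVec] at h
  rw [← h, Finset.sum_eq_single γ]
  · rw [if_pos rfl, smul_eq_mul, mul_one]
  · intro δ _ hne
    rw [if_neg hne, smul_zero]
  · exact fun h' => absurd hγ h'

/-- The operator `φ̂` on the linear span of `(d_γ)`: `φ̂(d_γ) = φ(κ(γ)) d_γ`. -/
def hat (C : Choices K) (φ : K → ℂ) :
    Submodule.span ℂ (Set.range (dVec C)) →ₗ[ℂ] space C :=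
  (Module.Basis.span (dVec_linearIndependent C)).constr ℂ fun γ => φ γ.1.kap • dVec C γ

/-- The operator `φ̂` on the linear span of `(d_γ^*)`: `φ̂(d_γ^*) = φ(κ(γ)) d_γ^*`. -/
def hatStar (C : Choices K) (φ : K → ℂ) :
    Submodule.span ℂ (Set.range (dStar C)) →ₗ[ℂ] (space C →L[ℂ] ℂ) :=
  (Module.Basis.span (dStar_linearIndependent C)).constr ℂ fun γ => φ γ.1.kap • dStar C γ

end BDCK

end

noncomputable section

set_option maxSynthPendingDepth 3

namespace BDCK

universe u

variable {K : Type u} [MetricSpace K] [CompactSpace K]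

/-! ### Compositions of the projections and the functionals -/

/-! Put `P = P_b - P_{a-1}` and split `e_γ^* ∘ P = d_γ^* ∘ P + c_γ^* ∘ P`. On the first summand `φ̂`
is exactly multiplication by `φ(κ(γ))`. If `c_γ^* = e_ξ^* + m_j⁻¹ λ e_η^* ∘ P_I`, the second is
`e_ξ^* ∘ P + m_j⁻¹ λ e_η^* ∘ P_{I ∩ [a,b]}`. Hence the error at `γ` is at most the error at `ξ`,
plus `m_j⁻¹` times the error at `η`, plus the cost of replacing `φ(κ(ξ))` and `φ(κ(η))` by
`φ(κ(γ))`.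

Every term carries the factor `m_j⁻¹ = weight γ`: `ξ` has the same weight as `γ`, and `|φ(κ(ξ)) -
φ(κ(γ))| ≤ L m_j⁻¹ 2^{-rank ξ}`. Suppose that errors are at most `A` times the weight. Now follow
`γ` back through its predecessors `ξ`. A step with `rank ξ > a` costs at most `m_j⁻¹ (16/3 L + A)
2^{-rank ξ}`, because the weight of `η` (where it matters) and the distance of `κ(η)` to `κ(γ)` are
at most `2^{-rank ξ}`. Ranks increase strictly, so these costs add up to at most `m_j⁻¹ (16/3 L + A)
2^{-a}`. Only one step starts at `rank ξ ≤ a` or without `ξ`. It is estimated crudely by `m_j⁻¹ (A/8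
+ 16/3 M + 8/3 L 2^{-a})`, and what lies before it has no error. The induction (`hatEstimate`)
closes if `A/8 + 16/3 M + (8L + A) 2^{-a} ≤ A`. This holds with `A = 7M` for large `a`, and for all
`a ≥ 1` with a larger `A`.

The second assertion follows by duality (`IsHat.apply_eq`): evaluating `φ̂ x` under `e_γ^* ∘ P` is
applying `φ̂(e_γ^* ∘ P)` to `x`, a functional of norm at most `A/8 + 8/3 M`. The large `A` with `a =
1` makes `φ̂` bounded, so it extends from the dense span of the `d_γ`; `A = 7M` with `a = N` gives
`7/8 + 8/3 < 4`. -/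

theorem extOp_apply_eq_finProj (C : Choices K) (m : ℕ) (x : Linf C) (γ : Idx C) {n : ℕ}
    (h : γ.1.rank ≤ n) : extOp C m x γ = finProj C.W n m (lift C x) γ.1 := by
  rw [extOp_apply, finProj_stable C.W m _ le_rfl (le_max_right m _),
    finProj_stable C.W m _ le_rfl h]

theorem lift_extOp (C : Choices K) (m : ℕ) (x : Linf C) {n : ℕ} {δ : Node K} (hδ : Gamma C δ)
    (h : δ.rank ≤ n) : lift C (extOp C m x) δ = finProj C.W n m (lift C x) δ := by
  rw [lift_apply C _ ⟨δ, hδ⟩, extOp_apply_eq_finProj C m x ⟨δ, hδ⟩ h]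

theorem extOp_extOp (C : Choices K) (a m : ℕ) (x : Linf C) :
    extOp C a (extOp C m x) = extOp C (min a m) x := by
  ext γ
  rw [extOp_apply_eq_finProj C a _ γ le_rfl, extOp_apply_eq_finProj C _ _ γ le_rfl,
    ← finProj_comp]
  exact finProj_congr_Gamma _ _ (fun δ hδ h _ => lift_extOp C m x hδ h) γ.2

theorem extOp_apply_of_rank_le (C : Choices K) {m : ℕ} (x : Linf C) {γ : Idx C}
    (h : γ.1.rank ≤ m) : extOp C m x γ = x γ := by
  rw [extOp_apply_eq_finProj C m x γ le_rfl, finProj_fix C.W _ le_rfl h, lift_apply]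

theorem extOp_eq_zero_of_forall (C : Choices K) {m : ℕ} {x : Linf C}
    (h : ∀ γ : Idx C, γ.1.rank ≤ m → x γ = 0) : extOp C m x = 0 := by
  ext γ
  rw [extOp_apply_eq_finProj C m x γ le_rfl,
    finProj_congr_Gamma (y := 0) _ _ (fun δ hδ _ h' => ?_) γ.2, map_zero]
  · rfl
  · rw [lift_apply C x ⟨δ, hδ⟩, h _ h']
    rfl

theorem proj_proj (C : Choices K) (a m : ℕ) : proj C a ∘L proj C m = proj C (min a m) := by
  ext1 x
  exact Subtype.ext (extOp_extOp C a m x.1)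

theorem proj_zero (C : Choices K) : proj C 0 = 0 := by
  ext1 x
  exact Subtype.ext (extOp_eq_zero_of_forall C fun γ h =>
    absurd γ.2.one_le_rank (by omega))

theorem eStar_comp_proj_of_le (C : Choices K) {γ : Idx C} {m : ℕ} (h : γ.1.rank ≤ m) :
    eStar C γ ∘L proj C m = eStar C γ := by
  ext1 x
  exact extOp_apply_of_rank_le C x.1 h

theorem cStar_apply (C : Choices K) (γ : Idx C) (x : space C) :
    cStar C γ x = cFun C.W γ.1 (lift C x.1) := rfl

/-- Below the rank of `γ`, the value at `γ` of an extension `i_m r_m x` is by construction `c_γ^*`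
of that extension. Consequently `d_γ^*` vanishes on the range of `P_m`. -/
theorem cStar_comp_proj_of_lt (C : Choices K) {γ : Idx C} {m : ℕ} (h : m < γ.1.rank) :
    cStar C γ ∘L proj C m = eStar C γ ∘L proj C m := by
  ext1 x
  have hE : (eStar C γ ∘L proj C m) x = extOp C m x.1 γ := rfl
  have hC : (cStar C γ ∘L proj C m) x = cFun C.W γ.1 (lift C (extOp C m x.1)) := rfl
  obtain ⟨n, hn⟩ : ∃ n, γ.1.rank = n + 1 := ⟨γ.1.rank - 1, by omega⟩
  rw [hE, hC, extOp_apply_eq_finProj C m _ γ hn.le, finProj_top C.W (by omega) _ hn]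
  have h2 : cFun C.W γ.1 = extFunctional C.W (finProj C.W n) γ.1 := by
    rw [cFun, hn, Nat.add_sub_cancel]
  rw [← h2]
  exact cFun_congr γ.2 fun ε hε hlt => lift_extOp C m _ hε (by omega)

/-- `c_γ^*` only involves coordinates of rank below `rank γ`, and `P_m` leaves these unchanged. -/
theorem cStar_comp_proj_of_le (C : Choices K) {γ : Idx C} {m : ℕ} (h : γ.1.rank ≤ m) :
    cStar C γ ∘L proj C m = cStar C γ := by
  ext1 x
  have hC : (cStar C γ ∘L proj C m) x = cFun C.W γ.1 (lift C (extOp C m x.1)) := rfl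
  rw [hC, cStar_apply]
  refine cFun_congr γ.2 fun ε hε hlt => ?_
  rw [lift_apply C _ ⟨ε, hε⟩, lift_apply C _ ⟨ε, hε⟩]
  exact extOp_apply_of_rank_le C _ (hlt.le.trans h)

theorem dStar_comp_proj_of_le (C : Choices K) {γ : Idx C} {m : ℕ} (h : γ.1.rank ≤ m) :
    dStar C γ ∘L proj C m = dStar C γ := by
  rw [dStar, ContinuousLinearMap.sub_comp, eStar_comp_proj_of_le C h, cStar_comp_proj_of_le C h]

theorem dStar_comp_proj_of_lt (C : Choices K) {γ : Idx C} {m : ℕ} (h : m < γ.1.rank) :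
    dStar C γ ∘L proj C m = 0 := by
  rw [dStar, ContinuousLinearMap.sub_comp, cStar_comp_proj_of_lt C h, sub_self]

/-! ### The functionals `e_γ^* ∘ P_{a, …, b}` -/

/-- The functional `e_γ^* ∘ (P_b - P_{a-1})`. -/
def eSeg (C : Choices K) (a b : ℕ) (γ : Idx C) : space C →L[ℂ] ℂ :=
  eStar C γ ∘L (proj C b - proj C (a - 1))

theorem norm_proj_le (C : Choices K) (m : ℕ) : ‖proj C m‖ ≤ 4 / 3 :=
  ContinuousLinearMap.opNorm_le_bound _ (by norm_num) fun x =>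
    lp.norm_le_of_forall_le (by positivity)
      (fun γ => norm_finProj_le C (norm_lift_le C x.1) _ _ γ.2)

theorem norm_eStar_le (C : Choices K) (γ : Idx C) : ‖eStar C γ‖ ≤ 1 :=
  LinearMap.mkContinuous_norm_le _ zero_le_one _

theorem norm_eSeg_le (C : Choices K) (a b : ℕ) (γ : Idx C) : ‖eSeg C a b γ‖ ≤ 8 / 3 := by
  have h1 := ContinuousLinearMap.opNorm_comp_le (eStar C γ) (proj C b - proj C (a - 1))
  have h2 := norm_sub_le (proj C b) (proj C (a - 1))
  have h3 : ‖eStar C γ‖ * ‖proj C b - proj C (a - 1)‖ ≤ 1 * ‖proj C b - proj C (a - 1)‖ := by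
    gcongr
    exact norm_eStar_le C γ
  have h4 := norm_proj_le C b
  have h5 := norm_proj_le C (a - 1)
  rw [eSeg]
  linarith

/-- `P_I P_J = P_{I ∩ J}`, a consequence of `P_a P_m = P_{min a m}`; the case distinction separates
off disjoint intervals. -/
theorem eSeg_comp_proj_sub (C : Choices K) {lo hi a b : ℕ} (γ : Idx C)
    (hlo : lo ≤ hi) (hab : a ≤ b) :
    eSeg C lo hi γ ∘L (proj C b - proj C (a - 1)) =
      if max lo a ≤ min hi b then eSeg C (max lo a) (min hi b) γ else 0 := by
  simp only [eSeg, ContinuousLinearMap.comp_assoc, ContinuousLinearMap.sub_comp,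
    ContinuousLinearMap.comp_sub, proj_proj]
  split_ifs with h
  · rw [show min (lo - 1) b = lo - 1 by omega, show min hi (a - 1) = a - 1 by omega]
    rcases le_total lo a with h' | h'
    · rw [show min (lo - 1) (a - 1) = lo - 1 by omega, max_eq_right h']
      abel
    · rw [show min (lo - 1) (a - 1) = a - 1 by omega, max_eq_left h']
      abel
  · rcases le_or_gt b (lo - 1) with h' | h'
    · rw [show min hi b = b by omega, show min (lo - 1) b = b by omega,
        show min hi (a - 1) = a - 1 by omega, show min (lo - 1) (a - 1) = a - 1 by omega]
      abel
    · rw [show min hi b = hi by omega, show min (lo - 1) b = lo - 1 by omega,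
        show min hi (a - 1) = hi by omega, show min (lo - 1) (a - 1) = lo - 1 by omega]
      abel

theorem dStar_comp_proj_sub (C : Choices K) {a b : ℕ} (γ : Idx C) (ha : 1 ≤ a) (hab : a ≤ b) :
    dStar C γ ∘L (proj C b - proj C (a - 1)) =
      if a ≤ γ.1.rank ∧ γ.1.rank ≤ b then dStar C γ else 0 := by
  rw [ContinuousLinearMap.comp_sub]
  split_ifs with h
  · rw [dStar_comp_proj_of_le C h.2, dStar_comp_proj_of_lt C (by omega), sub_zero]
  · rcases le_or_gt a γ.1.rank with h' | h'
    · rw [dStar_comp_proj_of_lt C (by omega), dStar_comp_proj_of_lt C (by omega), sub_zero]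
    · rw [dStar_comp_proj_of_le C (by omega), dStar_comp_proj_of_le C (by omega), sub_self]

theorem eSeg_of_rank_lt (C : Choices K) {a b : ℕ} {γ : Idx C} (hab : a ≤ b) (h : γ.1.rank < a) :
    eSeg C a b γ = 0 := by
  rw [eSeg, ContinuousLinearMap.comp_sub, eStar_comp_proj_of_le C (by omega),
    eStar_comp_proj_of_le C (by omega), sub_self]

theorem eSeg_of_rank_eq (C : Choices K) {a b : ℕ} {γ : Idx C} (hab : a ≤ b) (h : γ.1.rank = a) :
    eSeg C a b γ = dStar C γ := by
  have h1 := γ.2.one_le_rank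
  rw [eSeg, ContinuousLinearMap.comp_sub, eStar_comp_proj_of_le C (by omega),
    -- Since `a - 1 < rank γ`, the functional `e_γ^* ∘ P_{a-1}` equals `c_γ^* ∘ P_{a-1}`. It is even
    -- `c_γ^*`, which depends only on coordinates of rank at most `a - 1`.
    ← cStar_comp_proj_of_lt C (by omega), dStar]
  congr 1
  have hC : ∀ x, (cStar C γ ∘L proj C (a - 1)) x =
    cFun C.W γ.1 (lift C (extOp C (a - 1) x.1)) := fun x => rfl
  ext1 x
  rw [hC, cStar_apply]
  refine cFun_congr γ.2 fun ε hε hlt => ?_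
  rw [lift_apply C _ ⟨ε, hε⟩, lift_apply C _ ⟨ε, hε⟩]
  exact extOp_apply_of_rank_le C _ (show ε.rank ≤ a - 1 by omega)

theorem eSeg_eq_dStar_add (C : Choices K) (a b : ℕ) (γ : Idx C) :
    eSeg C a b γ = dStar C γ ∘L (proj C b - proj C (a - 1)) +
      cStar C γ ∘L (proj C b - proj C (a - 1)) := by
  rw [← ContinuousLinearMap.add_comp, dStar, sub_add_cancel, eSeg]

theorem eSeg_one (C : Choices K) {b : ℕ} {γ : Idx C} (h : γ.1.rank ≤ b) :
    eSeg C 1 b γ = eStar C γ := by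
  rw [eSeg, Nat.sub_self, proj_zero, sub_zero, eStar_comp_proj_of_le C h]

theorem cStar_base (C : Choices K) {n : ℕ} {κ : K} (h : Gamma C (.base n κ)) :
    cStar C ⟨_, h⟩ = 0 := rfl

theorem eSeg_apply_eq (C : Choices K) {n lo hi : ℕ} {η : Idx C} (h : η.1.rank ≤ n)
    (x : space C) : eSeg C lo hi η x = finProj C.W n hi (lift C x.1) η.1 -
      finProj C.W n (lo - 1) (lift C x.1) η.1 := by
  rw [← extOp_apply_eq_finProj C hi _ η h, ← extOp_apply_eq_finProj C (lo - 1) _ η h]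
  rfl

theorem cStar_first (C : Choices K) {n lo hi j : ℕ} {η : Node K} {lam : ℂ} {κ : K}
    (h : Gamma C (.first n lo hi η lam j κ)) (hη : Gamma C η) (hr : η.rank ≤ n - 1) :
    cStar C ⟨_, h⟩ = ((C.W.m j : ℂ)⁻¹ * lam) • eSeg C lo hi ⟨η, hη⟩ := by
  ext1 x
  rw [smul_apply, eSeg_apply_eq C (n := n - 1) hr, cStar_apply]
  rfl

theorem cStar_next (C : Choices K) {n lo hi j : ℕ} {ξ η : Node K} {lam : ℂ} {κ : K}
    (h : Gamma C (.next n ξ lo hi η lam j κ)) (hξ : Gamma C ξ) (hη : Gamma C η)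
    (hr : η.rank ≤ n - 1) :
    cStar C ⟨_, h⟩ = eStar C ⟨ξ, hξ⟩ +
      ((C.W.m j : ℂ)⁻¹ * lam) • eSeg C lo hi ⟨η, hη⟩ := by
  ext1 x
  rw [add_apply, smul_apply, eSeg_apply_eq C (n := n - 1) hr, cStar_apply]
  have : eStar C ⟨ξ, hξ⟩ x = lift C x.1 ξ := (lift_apply C x.1 ⟨ξ, hξ⟩).symm
  rw [this]
  rfl

/-! ### Consequences of membership in `Γ` -/

theorem Node.weight_nonneg {K : Type u} (W : WeightSeq) (γ : Node K) : 0 ≤ γ.weight W := by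
  cases γ <;> simp only [Node.weight] <;> positivity

theorem WeightSeq.inv_le (W : WeightSeq) {j : ℕ} (hj : 1 ≤ j) : (W.m j : ℝ)⁻¹ ≤ 1 / 8 := by
  have h2 : (8 : ℝ) ≤ W.m j := by exact_mod_cast W.eight_le hj
  rw [one_div]
  exact inv_anti₀ (by norm_num) h2

theorem Gamma.weight_le {C : Choices K} {γ : Node K} (h : Gamma C γ) :
    γ.weight C.W ≤ 1 / 8 := by
  have := h.bar
  cases this with
  | base => simp [Node.weight]
  | first => exact C.W.inv_le ‹_›
  | next => exact C.W.inv_le ‹_›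

theorem norm_inv_mul_le (W : WeightSeq) (j : ℕ) {n : ℕ} {z : ℂ} (hz : z ∈ discPts n) :
    ‖(W.m j : ℂ)⁻¹ * z‖ ≤ (W.m j : ℝ)⁻¹ := by
  rw [norm_mul, norm_inv, Complex.norm_natCast]
  exact mul_le_of_le_one_right (by positivity) (norm_le_one_of_mem_discPts hz)

theorem Gamma.of_first {C : Choices K} {n lo hi j : ℕ} {η : Node K} {lam : ℂ} {κ : K}
    (h : Gamma C (.first n lo hi η lam j κ)) :
    Gamma C η ∧ lo ≤ hi ∧ η.rank ≤ n - 1 ∧ ‖(C.W.m j : ℂ)⁻¹ * lam‖ ≤ (C.W.m j : ℝ)⁻¹ := by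
  have hη : Gamma C η := by cases h <;> assumption
  have hb := h.bar
  cases hb with
  | first _ _ _ _ _ _ _ _ _ hle _ _ hr hl =>
    exact ⟨hη, hle, by omega, norm_inv_mul_le C.W j hl⟩

theorem Gamma.of_next {C : Choices K} {n lo hi j : ℕ} {ξ η : Node K} {lam : ℂ} {κ : K}
    (h : Gamma C (.next n ξ lo hi η lam j κ)) :
    Gamma C ξ ∧ Gamma C η ∧ lo ≤ hi ∧ η.rank ≤ n - 1 ∧
      ‖(C.W.m j : ℂ)⁻¹ * lam‖ ≤ (C.W.m j : ℝ)⁻¹ ∧ ξ.rank + 1 ≤ n ∧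
      ξ.weight C.W = (C.W.m j : ℝ)⁻¹ := by
  have hη : Gamma C ξ ∧ Gamma C η := by cases h <;> exact ⟨‹_›, ‹_›⟩
  have hb := h.bar
  cases hb with
  | next _ _ _ _ _ _ _ _ _ _ hr hw _ _ hle _ _ hr' hl =>
    exact ⟨hη.1, hη.2, hle, by omega, norm_inv_mul_le C.W j hl, by omega, hw⟩

theorem Gamma.metric_of_next {C : Choices K} {n lo hi j : ℕ} {ξ η : Node K} {lam : ℂ} {κ : K}
    (h : Gamma C (.next n ξ lo hi η lam j κ)) :
    C.F.metric ξ.kap κ ≤ (C.W.m j : ℝ)⁻¹ * ((2 : ℝ) ^ ξ.rank)⁻¹ ∧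
      C.F.metric η.kap κ ≤ ((2 : ℝ) ^ ξ.rank)⁻¹ := by
  cases h <;> exact ⟨‹_›, ‹_›⟩

/-- For even `j` this is the condition on `weight(I, η)`. For odd `j` it comes from the growth
condition `m_{4σ(ξ)} > 2^{rank ξ}` on the coding. The case `rank η ≤ lo` may be left out, as such an
`η` contributes no error. -/
theorem Gamma.weight_of_next {C : Choices K} {n lo hi j : ℕ} {ξ η : Node K} {lam : ℂ} {κ : K}
    (h : Gamma C (.next n ξ lo hi η lam j κ)) (hlo : lo < η.rank) :
    η.weight C.W ≤ ((2 : ℝ) ^ ξ.rank)⁻¹ := by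
  have hle := h.of_next.2.2.1
  cases h with
  | nextEven _ _ _ _ _ _ _ _ _ _ _ _ hw =>
    rwa [Node.weightOn, csInf_Icc hle, if_neg (by omega)] at hw
  | nextOdd _ _ _ _ _ _ _ _ _ _ hξ _ hw =>
    rw [hw]
    exact inv_anti₀ (by positivity) (by exact_mod_cast (C.code_large ξ hξ.bar).le)

/-! ### Functionals on a normed space -/

section Dual

variable {𝕜 E : Type*} [NontriviallyNormedField 𝕜] [SeminormedAddCommGroup E] [NormedSpace 𝕜 E]

theorem dual_smul_zero (z : 𝕜) : z • (0 : E →L[𝕜] 𝕜) = 0 := smul_zero z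

theorem dual_norm_zero : ‖(0 : E →L[𝕜] 𝕜)‖ = 0 := norm_zero

theorem dual_norm_sub_self (f : E →L[𝕜] 𝕜) : ‖f - f‖ = 0 := by rw [sub_self, norm_zero]

/-- The price of changing the scalar: it serves to replace `φ(κ(ξ))` or `φ(κ(η))` by `φ(κ(γ))`. -/
theorem dual_norm_sub_smul_le (g e : E →L[𝕜] 𝕜) (w z : 𝕜) :
    ‖g - z • e‖ ≤ ‖g - w • e‖ + ‖w - z‖ * ‖e‖ := by
  rw [← norm_smul (w - z) e, show g - z • e = (g - w • e) + (w - z) • e by rw [sub_smul]; abel]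
  exact norm_add_le _ _

theorem dual_norm_first (d g e : E →L[𝕜] 𝕜) (c z : 𝕜) :
    ‖z • d + c • g - z • (d + c • e)‖ = ‖c‖ * ‖g - z • e‖ := by
  rw [← norm_smul c]
  congr 1
  rw [smul_add, smul_sub, smul_comm c]
  abel

/-- The recursion for the errors: `d` cancels, `f` and `g` are the images of the parts `e'` and `e`
coming from `ξ` and `η`, and `w`, `z` stand for `φ(κ(ξ))`, `φ(κ(γ))`. -/
theorem dual_norm_next_le (d f g e e' : E →L[𝕜] 𝕜) (c w z : 𝕜) :
    ‖z • d + (f + c • g) - z • (d + (e' + c • e))‖ ≤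
      ‖f - w • e'‖ + ‖w - z‖ * ‖e'‖ + ‖c‖ * ‖g - z • e‖ := by
  have h : z • d + (f + c • g) - z • (d + (e' + c • e)) = (f - z • e') + c • (g - z • e) := by
    rw [smul_add, smul_add, smul_sub, smul_comm c]
    abel
  rw [h, ← norm_smul c]
  exact (norm_add_le _ _).trans (add_le_add_left (dual_norm_sub_smul_le f e' w z) _)

end Dual

/-- The vector `f` lies in the domain of `T`, and `T` maps it to `g`. -/
def IsImage {V V' : Type*} [AddCommMonoid V] [Module ℂ V] [AddCommMonoid V'] [Module ℂ V']
    {S : Submodule ℂ V} (T : S →ₗ[ℂ] V') (f : V) (g : V') : Prop :=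
  ∃ h : f ∈ S, T ⟨f, h⟩ = g

section IsImage

variable {V V' : Type*} [AddCommMonoid V] [Module ℂ V] [AddCommMonoid V'] [Module ℂ V']
  {S : Submodule ℂ V} {T : S →ₗ[ℂ] V'}

theorem IsImage.add {f f' : V} {g g' : V'} (h : IsImage T f g) (h' : IsImage T f' g') :
    IsImage T (f + f') (g + g') := by
  obtain ⟨h, rfl⟩ := h
  obtain ⟨h', rfl⟩ := h'
  exact ⟨add_mem h h', map_add T ⟨f, h⟩ ⟨f', h'⟩⟩

theorem IsImage.smul {f : V} {g : V'} (c : ℂ) (h : IsImage T f g) : IsImage T (c • f) (c • g) := by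
  obtain ⟨h, rfl⟩ := h
  exact ⟨Submodule.smul_mem _ c h, map_smul T c ⟨f, h⟩⟩

theorem isImage_zero : IsImage T 0 0 := ⟨zero_mem _, map_zero T⟩

theorem isImage_basis_constr {ι : Type*} {v : ι → V} (hv : LinearIndependent ℂ v) (w : ι → V')
    (i : ι) : IsImage ((Module.Basis.span hv).constr ℂ w) (v i) (w i) := by
  refine ⟨Submodule.subset_span ⟨i, rfl⟩, ?_⟩
  have hb : (⟨v i, Submodule.subset_span ⟨i, rfl⟩⟩ : Submodule.span ℂ (Set.range v)) =
      Module.Basis.span hv i := (Module.Basis.span_apply hv i).symm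
  rw [hb, Module.Basis.constr_basis]

end IsImage

/-! ### The graph of `φ̂` on the span of the coordinate functionals -/

/-- The functional `f` lies in the span of `(d_γ^*)` and `φ̂(f) = g`. -/
def IsHat (C : Choices K) (φ : K → ℂ) (f g : space C →L[ℂ] ℂ) : Prop :=
  IsImage (hatStar C φ) f g

variable {C : Choices K} {φ : K → ℂ}

theorem IsHat.add {f g f' g' : space C →L[ℂ] ℂ} (h : IsHat C φ f g) (h' : IsHat C φ f' g') :
    IsHat C φ (f + f') (g + g') := IsImage.add h h'

theorem IsHat.smul {f g : space C →L[ℂ] ℂ} (c : ℂ) (h : IsHat C φ f g) :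
    IsHat C φ (c • f) (c • g) := IsImage.smul c h

theorem isHat_zero : IsHat C φ 0 0 := isImage_zero

theorem isHat_zero_smul (z : ℂ) : IsHat C φ 0 (z • 0) := by
  have h : z • (0 : space C →L[ℂ] ℂ) = 0 := dual_smul_zero z
  rw [h]
  exact isHat_zero

theorem isHat_dStar (γ : Idx C) : IsHat C φ (dStar C γ) (φ γ.1.kap • dStar C γ) :=
  isImage_basis_constr (dStar_linearIndependent C) _ γ

theorem isHat_dStar_comp {a b : ℕ} (γ : Idx C) (ha : 1 ≤ a) (hab : a ≤ b) :
    IsHat C φ (dStar C γ ∘L (proj C b - proj C (a - 1)))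
      (φ γ.1.kap • (dStar C γ ∘L (proj C b - proj C (a - 1)))) := by
  rw [dStar_comp_proj_sub C γ ha hab]
  split_ifs
  · exact isHat_dStar γ
  · exact isHat_zero_smul _

theorem isHat_eSeg_of_rank_le {a b : ℕ} {γ : Idx C} (hab : a ≤ b) (h : γ.1.rank ≤ a) :
    IsHat C φ (eSeg C a b γ) (φ γ.1.kap • eSeg C a b γ) := by
  rcases h.lt_or_eq with h | h
  · rw [eSeg_of_rank_lt C hab h]
    exact isHat_zero_smul _
  · rw [eSeg_of_rank_eq C hab h]
    exact isHat_dStar γ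

/-! ### The estimate for `φ̂(e_γ^* ∘ P_I) - φ(κ(γ)) e_γ^* ∘ P_I` -/

/-- The bound that the induction on the age of `γ` produces for nodes of rank `r`. -/
def ageBound (L M A : ℝ) (a r : ℕ) : ℝ :=
  A / 8 + 16 / 3 * M + 8 / 3 * L * ((2 : ℝ) ^ a)⁻¹ +
    (16 / 3 * L + A) * (((2 : ℝ) ^ a)⁻¹ - 2 * ((2 : ℝ) ^ r)⁻¹)

theorem inv_two_pow_le {r r' : ℕ} (h : r + 1 ≤ r') :
    2 * ((2 : ℝ) ^ r')⁻¹ ≤ ((2 : ℝ) ^ r)⁻¹ := by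
  calc 2 * ((2 : ℝ) ^ r')⁻¹ ≤ 2 * ((2 : ℝ) ^ (r + 1))⁻¹ := by
        gcongr
        norm_num
    _ = ((2 : ℝ) ^ r)⁻¹ := by
        rw [pow_succ, mul_inv]
        ring

/-- Dropping the negative term `-2 · 2^{-r}` leaves the sum of all costs, `A/8 + 16/3 M + (8L + A)
2^{-a}`. The hypothesis at `s` is thus what lets one constant `A` reproduce itself in the induction.
-/
theorem ageBound_le {L M A : ℝ} {s a : ℕ} (hL : 0 ≤ L) (hA : 0 ≤ A) (hs : s ≤ a)
    (h : A / 8 + 16 / 3 * M + (8 * L + A) * ((2 : ℝ) ^ s)⁻¹ ≤ A) (r : ℕ) :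
    ageBound L M A a r ≤ A := by
  have h1 : ((2 : ℝ) ^ a)⁻¹ ≤ ((2 : ℝ) ^ s)⁻¹ := by
    gcongr
    norm_num
  have h2 : 0 ≤ ((2 : ℝ) ^ r)⁻¹ := by positivity
  have h3 : (8 * L + A) * ((2 : ℝ) ^ a)⁻¹ ≤ (8 * L + A) * ((2 : ℝ) ^ s)⁻¹ := by gcongr
  have h4 : 0 ≤ (16 / 3 * L + A) * (2 * ((2 : ℝ) ^ r)⁻¹) := by positivity
  rw [ageBound]
  linarith

/-- The cost of the one step that crosses `a`; the remaining term of `ageBound` is non-negative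
because `2 · 2^{-r} ≤ 2^{-a}`. -/
theorem le_ageBound {L M A : ℝ} {a r : ℕ} (hL : 0 ≤ L) (hA : 0 ≤ A) (h : a + 1 ≤ r) :
    A / 8 + 16 / 3 * M + 8 / 3 * L * ((2 : ℝ) ^ a)⁻¹ ≤ ageBound L M A a r := by
  have h1 := inv_two_pow_le h
  have : 0 ≤ (16 / 3 * L + A) * (((2 : ℝ) ^ a)⁻¹ - 2 * ((2 : ℝ) ^ r)⁻¹) :=
    mul_nonneg (by positivity) (by linarith)
  rw [ageBound]
  linarith

/-- The term `-2 · 2^{-r}` makes the geometric sum telescope: `2 · 2^{-r} - 2 · 2^{-r'} ≥ 2^{-r}`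
when the rank grows by at least one. -/
theorem ageBound_step {L M A : ℝ} {a r r' : ℕ} (hL : 0 ≤ L) (hA : 0 ≤ A) (h : r + 1 ≤ r') :
    ageBound L M A a r + (16 / 3 * L + A) * ((2 : ℝ) ^ r)⁻¹ ≤ ageBound L M A a r' := by
  have h1 := inv_two_pow_le h
  have : 0 ≤ (16 / 3 * L + A) * (((2 : ℝ) ^ r)⁻¹ - 2 * ((2 : ℝ) ^ r')⁻¹) :=
    mul_nonneg (by positivity) (by linarith)
  rw [ageBound, ageBound]
  linarith

/-- The conclusion of the induction, for a node `γ` and all intervals with minimum at least `s`. -/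
def HatEstimate (C : Choices K) (φ : K → ℂ) (L M A : ℝ) (s : ℕ) (γ : Idx C) : Prop :=
  ∀ a b, s ≤ a → a ≤ b → ∃ g, IsHat C φ (eSeg C a b γ) g ∧
    (γ.1.rank ≤ a → g = φ γ.1.kap • eSeg C a b γ) ∧
    (a < γ.1.rank →
      ‖g - φ γ.1.kap • eSeg C a b γ‖ ≤ γ.1.weight C.W * ageBound L M A a γ.1.rank)

/-- The contribution of `η`. The intersection of the two intervals still starts at or after `s`, so
the estimate for `η` applies to it. No error arises if `rank η ≤ max lo a`, so the bound `w` on the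
weight is needed only if `lo < rank η`. -/
theorem HatEstimate.comp {L M A : ℝ} {s : ℕ} {η : Idx C} (hη : HatEstimate C φ L M A s η)
    (hL : 0 ≤ L) (hA : 0 ≤ A)
    (hs : A / 8 + 16 / 3 * M + (8 * L + A) * ((2 : ℝ) ^ s)⁻¹ ≤ A)
    {a b lo hi : ℕ} (ha : s ≤ a) (hab : a ≤ b) (hle : lo ≤ hi) {w : ℝ} (hw0 : 0 ≤ w)
    (hw : lo < η.1.rank → η.1.weight C.W ≤ w) (z : ℂ) :
    ∃ g, IsHat C φ (eSeg C lo hi η ∘L (proj C b - proj C (a - 1))) g ∧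
      ‖g - z • (eSeg C lo hi η ∘L (proj C b - proj C (a - 1)))‖ ≤
        A * w + 8 / 3 * ‖φ η.1.kap - z‖ := by
  rw [eSeg_comp_proj_sub C η hle hab]
  split_ifs with h
  · obtain ⟨g, h1, h2, h3⟩ := hη _ _ (ha.trans (le_max_right lo a)) h
    refine ⟨g, h1, ?_⟩
    set e := eSeg C (max lo a) (min hi b) η
    have h5 : ‖φ η.1.kap - z‖ * ‖e‖ ≤ 8 / 3 * ‖φ η.1.kap - z‖ := by
      rw [mul_comm]
      gcongr
      exact norm_eSeg_le C _ _ η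
    have h6 : ‖g - φ η.1.kap • e‖ ≤ A * w := by
      rcases le_or_gt η.1.rank (max lo a) with h' | h'
      · rw [h2 h']
        exact (dual_norm_sub_self _).trans_le (by positivity)
      · refine (h3 h').trans ?_
        rw [mul_comm]
        have := ageBound_le (M := M) hL hA (ha.trans (le_max_right lo a)) hs η.1.rank
        calc _ ≤ A * η.1.weight C.W := by
              gcongr
              exact Node.weight_nonneg _ _
          _ ≤ A * w := by
              gcongr
              exact hw (by omega)
    exact (dual_norm_sub_smul_le g e (φ η.1.kap) z).trans (add_le_add h6 h5)
  · refine ⟨0, isHat_zero, ?_⟩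
    rw [show z • (0 : space C →L[ℂ] ℂ) = 0 from dual_smul_zero z]
    exact (dual_norm_sub_self _).trans_le (by positivity)

set_option maxHeartbeats 1000000 in
theorem hatEstimate {L M A : ℝ} {s : ℕ} (hL : 0 ≤ L) (hA : 0 ≤ A) (hs1 : 1 ≤ s)
    (hs : A / 8 + 16 / 3 * M + (8 * L + A) * ((2 : ℝ) ^ s)⁻¹ ≤ A)
    (hLip : ∀ x y, ‖φ x - φ y‖ ≤ L * C.F.metric x y) (hφ : ∀ x, ‖φ x‖ ≤ M)
    (γ : Node K) (hγ : Gamma C γ) : HatEstimate C φ L M A s ⟨γ, hγ⟩ := by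
  have hdiff : ∀ x y, ‖φ x - φ y‖ ≤ 2 * M := fun x y => by
    linarith [norm_sub_le (φ x) (φ y), hφ x, hφ y]
  -- Structural induction supplies the estimate for `ξ` and `η` simultaneously.
  induction γ with
  | base n κ =>
    intro a b ha hab
    have h1 : eSeg C a b ⟨_, hγ⟩ = dStar C ⟨_, hγ⟩ ∘L (proj C b - proj C (a - 1)) := by
      rw [eSeg_eq_dStar_add, cStar_base, ContinuousLinearMap.zero_comp, add_zero]
    refine ⟨_, ?_, fun _ => rfl, fun _ => ?_⟩
    · rw [h1]
      exact isHat_dStar_comp _ (hs1.trans ha) hab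
    · refine (dual_norm_sub_self _).trans_le ?_
      simp [Node.weight]
  | first n lo hi η lam j κ ih =>
    intro a b ha hab
    rcases le_or_gt (Node.first n lo hi η lam j κ).rank a with hr | hr
    · exact ⟨_, isHat_eSeg_of_rank_le hab hr, fun _ => rfl, fun h => absurd h hr.not_gt⟩
    obtain ⟨hη, hle, hrη, hc⟩ := hγ.of_first
    -- At age one nothing ties `η` to `κ`, so only the crude bounds `weight η ≤ 1/8` and `|φ(κ(η)) -
    -- φ(κ)| ≤ 2M` are used.
    obtain ⟨g, hg, hgn⟩ := (ih hη).comp hL hA hs ha hab hle (w := 1 / 8) (by norm_num)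
      (fun _ => hη.weight_le) (φ κ)
    have hsum : eSeg C a b ⟨_, hγ⟩ = dStar C ⟨_, hγ⟩ ∘L (proj C b - proj C (a - 1)) +
        ((C.W.m j : ℂ)⁻¹ * lam) • (eSeg C lo hi ⟨η, hη⟩ ∘L (proj C b - proj C (a - 1))) := by
      rw [eSeg_eq_dStar_add, cStar_first C hγ hη hrη, ContinuousLinearMap.smul_comp]
    refine ⟨_, hsum ▸ (isHat_dStar_comp _ (hs1.trans ha) hab).add (hg.smul _),
      fun h => absurd h hr.not_ge, fun _ => ?_⟩
    rw [hsum]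
    set e := eSeg C lo hi ⟨η, hη⟩ ∘L (proj C b - proj C (a - 1))
    set d := dStar C ⟨_, hγ⟩ ∘L (proj C b - proj C (a - 1))
    set c := (C.W.m j : ℂ)⁻¹ * lam
    have hk : (Node.first n lo hi η lam j κ).kap = κ := rfl
    simp only [hk]
    refine (dual_norm_first d g e c (φ κ)).trans_le ?_
    have h2 := le_ageBound (M := M) hL hA hr
    have h3 := hdiff η.kap κ
    have h4 : 0 ≤ 8 / 3 * L * ((2 : ℝ) ^ a)⁻¹ := by positivity
    have h5 : (C.W.m j : ℝ)⁻¹ = (Node.first n lo hi η lam j κ).weight C.W := rfl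
    rw [← h5]
    calc _ ≤ (C.W.m j : ℝ)⁻¹ * (A * (1 / 8) + 8 / 3 * ‖φ η.kap - φ κ‖) := by
          gcongr
      _ ≤ _ := by
          gcongr
          linarith
  | next n ξ lo hi η lam j κ ihξ ih =>
    intro a b ha hab
    rcases le_or_gt (Node.next n ξ lo hi η lam j κ).rank a with hr | hr
    · exact ⟨_, isHat_eSeg_of_rank_le hab hr, fun _ => rfl, fun h => absurd h hr.not_gt⟩
    obtain ⟨hξ, hη, hle, hrη, hc, hrξ, hwξ⟩ := hγ.of_next
    obtain ⟨hmξ, hmη⟩ := hγ.metric_of_next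
    have hsum : eSeg C a b ⟨_, hγ⟩ = dStar C ⟨_, hγ⟩ ∘L (proj C b - proj C (a - 1)) +
        (eSeg C a b ⟨ξ, hξ⟩ +
        ((C.W.m j : ℂ)⁻¹ * lam) • (eSeg C lo hi ⟨η, hη⟩ ∘L (proj C b - proj C (a - 1)))) := by
      rw [eSeg_eq_dStar_add, cStar_next C hγ hξ hη hrη, ContinuousLinearMap.add_comp,
        ContinuousLinearMap.smul_comp]
      rfl
    obtain ⟨f, hf, hf1, hf2⟩ := ihξ hξ a b ha hab
    -- The bound `2^{-rank ξ}` on the weight of `η` is useful only for `rank ξ > a`, where it is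
    -- summed geometrically; otherwise `1/8` is taken.
    have hwη : ∃ w : ℝ, 0 ≤ w ∧ (lo < η.rank → η.weight C.W ≤ w) ∧
        (ξ.rank ≤ a → w ≤ 1 / 8) ∧ (a < ξ.rank → w ≤ ((2 : ℝ) ^ ξ.rank)⁻¹) := by
      rcases le_or_gt ξ.rank a with h | h
      · exact ⟨1 / 8, by norm_num, fun _ => hη.weight_le, fun _ => le_rfl,
          fun h' => absurd h' h.not_gt⟩
      · exact ⟨_, by positivity, fun h' => hγ.weight_of_next h', fun h' => absurd h h'.not_gt,
          fun _ => le_rfl⟩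
    obtain ⟨w, hw0, hw, hw1, hw2⟩ := hwη
    obtain ⟨g, hg, hgn⟩ := (ih hη).comp hL hA hs ha hab hle hw0 hw (φ κ)
    refine ⟨_, hsum ▸ (isHat_dStar_comp _ (hs1.trans ha) hab).add (hf.add (hg.smul _)),
      fun h => absurd h hr.not_ge, fun _ => ?_⟩
    rw [hsum]
    -- The functional `e_ξ^* ∘ P` vanishes if `rank ξ < a`. For `rank ξ ≥ a` the condition on
    -- `ϱ(κ(ξ), κ)` supplies the factor `m_j⁻¹`.
    have hx : ‖φ ξ.kap - φ κ‖ * ‖eSeg C a b ⟨ξ, hξ⟩‖ ≤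
        (C.W.m j : ℝ)⁻¹ * (8 / 3 * L * ((2 : ℝ) ^ max ξ.rank a)⁻¹) := by
      rcases lt_or_ge ξ.rank a with h | h
      · rw [eSeg_of_rank_lt C hab h,
          show ‖(0 : space C →L[ℂ] ℂ)‖ = 0 from dual_norm_zero, mul_zero]
        positivity
      · rw [max_eq_left h]
        calc ‖φ ξ.kap - φ κ‖ * ‖eSeg C a b ⟨ξ, hξ⟩‖
            ≤ (L * ((C.W.m j : ℝ)⁻¹ * ((2 : ℝ) ^ ξ.rank)⁻¹)) * (8 / 3) := by
              gcongr
              · exact (hLip _ _).trans (by gcongr)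
              · exact norm_eSeg_le C _ _ _
          _ = _ := by ring
    set e := eSeg C lo hi ⟨η, hη⟩ ∘L (proj C b - proj C (a - 1))
    set e' := eSeg C a b ⟨ξ, hξ⟩
    set d := dStar C ⟨_, hγ⟩ ∘L (proj C b - proj C (a - 1))
    set c := (C.W.m j : ℂ)⁻¹ * lam
    have hk : (Node.next n ξ lo hi η lam j κ).kap = κ := rfl
    simp only [hk]
    have hcg : ‖c‖ * ‖g - φ κ • e‖ ≤
        (C.W.m j : ℝ)⁻¹ * (A * w + 8 / 3 * ‖φ η.kap - φ κ‖) := by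
      gcongr
    refine (dual_norm_next_le d f g e e' c (φ ξ.kap) (φ κ)).trans ?_
    have hwt : (Node.next n ξ lo hi η lam j κ).weight C.W = (C.W.m j : ℝ)⁻¹ := rfl
    have hrk : (Node.next n ξ lo hi η lam j κ).rank = n := rfl
    have hm0 : 0 ≤ (C.W.m j : ℝ)⁻¹ := by positivity
    simp only [hwt, hrk] at hr ⊢
    -- Either this step crosses `a`, with no error inherited from `ξ`, or the error of `ξ` is passed
    -- on with increment `(16/3 L + A) 2^{-rank ξ}`.
    rcases le_or_gt ξ.rank a with h | h
    · have h3 : ‖f - φ ξ.kap • e'‖ = 0 := by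
        rw [hf1 h]
        exact dual_norm_sub_self _
      rw [max_eq_right h] at hx
      have h4 := le_ageBound (M := M) hL hA hr
      have h5 := hdiff η.kap κ
      have h6 : A * w ≤ A * (1 / 8) := mul_le_mul_of_nonneg_left (hw1 h) hA
      have h7 := mul_le_mul_of_nonneg_left (a := (C.W.m j : ℝ)⁻¹)
        (show 8 / 3 * L * ((2 : ℝ) ^ a)⁻¹ + (A * w + 8 / 3 * ‖φ η.kap - φ κ‖) ≤
          ageBound L M A a n by linarith) hm0
      rw [h3]
      linarith
    · have h3 := hf2 h
      simp only [hwξ] at h3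
      rw [max_eq_left h.le] at hx
      have h4 := ageBound_step (M := M) (a := a) hL hA hrξ
      have h5 : ‖φ η.kap - φ κ‖ ≤ L * ((2 : ℝ) ^ ξ.rank)⁻¹ :=
        (hLip _ _).trans (mul_le_mul_of_nonneg_left hmη hL)
      have h6 : A * w ≤ A * ((2 : ℝ) ^ ξ.rank)⁻¹ := mul_le_mul_of_nonneg_left (hw2 h) hA
      have h7 := mul_le_mul_of_nonneg_left (a := (C.W.m j : ℝ)⁻¹)
        (show ageBound L M A a ξ.rank + 8 / 3 * L * ((2 : ℝ) ^ ξ.rank)⁻¹ +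
          (A * w + 8 / 3 * ‖φ η.kap - φ κ‖) ≤ ageBound L M A a n by linarith) hm0
      linarith

/-! ### Density of the span of the basis vectors -/

theorem finite_discPts (n : ℕ) : (discPts n).Finite := by
  refine (((Set.finite_Iic (2 ^ n)).prod (Set.finite_Iic (2 ^ n))).image fun p : ℕ × ℕ =>
    ((p.1 : ℂ) / 2 ^ n) * Complex.exp (Complex.I * ((p.2 : ℂ) / 2 ^ n * (2 * Real.pi)))).subset ?_
  rintro z ⟨k₁, k₂, -, h1, -, h2, rfl⟩
  exact ⟨(k₁, k₂), ⟨h1, h2⟩, rfl⟩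

/-- Finiteness of `Γ_n` is what makes each `Y_n` lie in the algebraic span of the `d_γ`. -/
theorem finite_gammaBar_rank_le {K : Type u} (W : WeightSeq) (net : ℕ → Finset K) (n : ℕ) :
    {γ : Node K | GammaBar W net γ ∧ γ.rank ≤ n}.Finite := by
  induction n with
  | zero =>
    refine Set.finite_empty.subset ?_
    rintro γ ⟨h, hr⟩
    exfalso
    cases h <;> simp only [Node.rank] at hr <;> omega
  | succ n ih =>
    set S := {γ : Node K | GammaBar W net γ ∧ γ.rank ≤ n}
    have h1 := (net (n + 1)).finite_toSet.image (Node.base (n + 1))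
    have hP := (Set.finite_Iic n).prod ((Set.finite_Iic n).prod (ih.prod
      ((finite_discPts (n + 1)).prod
        ((Set.finite_Iic (n + 1)).prod (net (n + 1)).finite_toSet))))
    have h2 := hP.image fun p => Node.first (n + 1) p.1 p.2.1 p.2.2.1 p.2.2.2.1 p.2.2.2.2.1
      p.2.2.2.2.2
    have h3 := (ih.prod hP).image fun q => Node.next (n + 1) q.1 q.2.1 q.2.2.1 q.2.2.2.1
      q.2.2.2.2.1 q.2.2.2.2.2.1 q.2.2.2.2.2.2
    refine (((ih.union h1).union h2).union h3).subset ?_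
    rintro γ ⟨h, hr⟩
    rcases Nat.lt_or_ge n γ.rank with hlt | hle
    · have hr' : γ.rank = n + 1 := by omega
      cases h with
      | base m κ _ hκ =>
        obtain rfl : m = n + 1 := hr'
        exact Or.inl (Or.inl (Or.inr ⟨κ, hκ, rfl⟩))
      | first m lo hi η lam j κ _ _ hlo hhi hη hrη hl _ hj hκ =>
        obtain rfl : m = n := Nat.succ.inj hr'
        exact Or.inl (Or.inr ⟨(lo, hi, η, lam, j, κ),
          ⟨hlo.trans hhi, hhi, ⟨hη, hrη⟩, hl, hj, hκ⟩, rfl⟩)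
      | next m ξ lo hi η lam j κ _ hξ hrξ _ _ _ hlo hhi hη hrη hl _ hj hκ =>
        obtain rfl : m = n := Nat.succ.inj hr'
        exact Or.inr ⟨(ξ, lo, hi, η, lam, j, κ),
          ⟨⟨hξ, hrξ.trans (Nat.sub_le _ _)⟩, hlo.trans hhi, hhi, ⟨hη, hrη⟩, hl, hj, hκ⟩, rfl⟩
    · exact Or.inl (Or.inl (Or.inl ⟨h, hle⟩))

theorem finite_idx_rank_le (C : Choices K) (n : ℕ) : {γ : Idx C | γ.1.rank ≤ n}.Finite :=
  Set.Finite.of_finite_image ((finite_gammaBar_rank_le C.W C.net n).subset (by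
    rintro _ ⟨γ, h, rfl⟩
    exact ⟨γ.2.bar, h⟩)) Subtype.val_injective.injOn

theorem extOp_mem_span (C : Choices K) (n : ℕ) (x : Linf C) :
    extOp C n x ∈ Submodule.span ℂ (Set.range fun γ => (dVec C γ : Linf C)) := by
  classical
  induction n generalizing x with
  | zero =>
    rw [extOp_eq_zero_of_forall C fun γ h => absurd γ.2.one_le_rank (by omega)]
    exact zero_mem _
  | succ n ih =>
    -- `y` vanishes on `Γ_n`, so only nodes of rank exactly `n + 1` contribute to `i_{n+1} r_{n+1}
    -- y`; for these `i_{n+1}(e_γ) = d_γ`.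
    set y := x - extOp C n x with hy
    have hx : extOp C (n + 1) x = extOp C n x + extOp C (n + 1) y := by
      rw [hy, map_sub, extOp_extOp, min_eq_right (Nat.le_succ n)]
      abel
    rw [hx]
    refine add_mem (ih x) ?_
    set F := (finite_idx_rank_le C (n + 1)).toFinset
    have h0 : extOp C (n + 1) (y - ∑ γ ∈ F, y γ • lp.single ∞ γ (1 : ℂ)) = 0 := by
      refine extOp_eq_zero_of_forall C fun δ hδ => ?_
      have hF : δ ∈ F := by simpa [F] using hδ
      rw [lp.coeFn_sub, Pi.sub_apply, lp.coeFn_sum, Finset.sum_apply,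
        Finset.sum_eq_single δ]
      · simp [lp.single_apply]
      · intro γ _ hne
        simp [lp.single_apply, hne.symm]
      · exact fun h => absurd hF h
    rw [map_sub, sub_eq_zero, map_sum] at h0
    rw [h0]
    refine sum_mem fun γ hγ => ?_
    rw [map_smul]
    have hr : γ.1.rank ≤ n + 1 := by simpa [F] using hγ
    rcases hr.lt_or_eq with h | h
    · have : y γ = 0 := by
        rw [hy, lp.coeFn_sub, Pi.sub_apply, extOp_apply_of_rank_le C x (by omega), sub_self]
      rw [this, zero_smul]
      exact zero_mem _
    · refine Submodule.smul_mem _ _ (Submodule.subset_span ⟨γ, ?_⟩)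
      simp only [dVec, h]

theorem denseRange_span_dVec (C : Choices K) :
    DenseRange (Submodule.span ℂ (Set.range (dVec C))).subtype := by
  intro x
  rw [closure_subtype]
  have hx : (x : Linf C) ∈ closure ((⨆ n, levelSpace C n : Submodule ℂ (Linf C)) : Set (Linf C)) :=
    x.2
  refine closure_mono ?_ hx
  have hle : (⨆ n, levelSpace C n) ≤
      (Submodule.span ℂ (Set.range (dVec C))).map (space C).subtype := by
    refine iSup_le fun n => ?_
    rintro _ ⟨y, rfl⟩
    rw [Submodule.map_span, ← Set.range_comp]
    exact extOp_mem_span C n y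
  intro y hy
  obtain ⟨z, hz, rfl⟩ := hle hy
  exact ⟨z, ⟨⟨z, hz⟩, rfl⟩, rfl⟩

/-! ### Duality and bounds -/

theorem hat_basis (γ : Idx C) : hat C φ (Module.Basis.span (dVec_linearIndependent C) γ) =
    φ γ.1.kap • dVec C γ := by
  rw [hat, Module.Basis.constr_basis]

theorem hatStar_dStar_apply (γ : Idx C) (x : Submodule.span ℂ (Set.range (dVec C))) :
    φ γ.1.kap * dStar C γ x.1 = dStar C γ (hat C φ x) := by
  classical
  have h : φ γ.1.kap • ((dStar C γ).toLinearMap ∘ₗ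
      (Submodule.span ℂ (Set.range (dVec C))).subtype) =
      (dStar C γ).toLinearMap ∘ₗ hat C φ := by
    refine (Module.Basis.span (dVec_linearIndependent C)).ext fun δ => ?_
    have hb : ((Module.Basis.span (dVec_linearIndependent C) δ : Submodule.span ℂ _) : space C) =
        dVec C δ := congrArg Subtype.val (Module.Basis.span_apply (dVec_linearIndependent C) δ)
    rw [LinearMap.comp_apply, hat_basis, LinearMap.smul_apply, LinearMap.comp_apply,
      Submodule.subtype_apply, hb, map_smul, ContinuousLinearMap.coe_coe, dStar_dVec]
    split_ifs with h
    · rw [h]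
    · simp
  exact congrArg (fun f => f x) h

/-- The two maps `φ̂` are adjoint: by linearity in `f` and in `x` this reduces to the
biorthogonality of `d_γ^*` and `d_δ`. -/
theorem IsHat.apply_eq {f g : space C →L[ℂ] ℂ} (h : IsHat C φ f g)
    (x : Submodule.span ℂ (Set.range (dVec C))) : g x.1 = f (hat C φ x) := by
  obtain ⟨h, rfl⟩ := h
  have key : (ContinuousLinearMap.apply ℂ ℂ x.1).toLinearMap ∘ₗ hatStar C φ =
      (ContinuousLinearMap.apply ℂ ℂ (hat C φ x)).toLinearMap ∘ₗ
        (Submodule.span ℂ (Set.range (dStar C))).subtype := by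
    refine (Module.Basis.span (dStar_linearIndependent C)).ext fun γ => ?_
    have hb : ((Module.Basis.span (dStar_linearIndependent C) γ : Submodule.span ℂ _) :
        space C →L[ℂ] ℂ) = dStar C γ :=
      congrArg Subtype.val (Module.Basis.span_apply (dStar_linearIndependent C) γ)
    rw [LinearMap.comp_apply, LinearMap.comp_apply, hatStar, Module.Basis.constr_basis,
      Submodule.subtype_apply, hb]
    exact hatStar_dStar_apply γ x
  exact congrArg (fun F => F ⟨f, h⟩) key

/-- The constants `L`, `M`, `A` are admissible for intervals with minimum at least `s`, for the
function `φ`. -/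
structure Admissible (C : Choices K) (φ : K → ℂ) (L M A : ℝ) (s : ℕ) : Prop where
  nonneg_L : 0 ≤ L
  nonneg_A : 0 ≤ A
  one_le : 1 ≤ s
  bound : A / 8 + 16 / 3 * M + (8 * L + A) * ((2 : ℝ) ^ s)⁻¹ ≤ A
  lipschitz : ∀ x y, ‖φ x - φ y‖ ≤ L * C.F.metric x y
  norm_le : ∀ x, ‖φ x‖ ≤ M

theorem Admissible.exists_isHat {L M A : ℝ} {s : ℕ} (h : Admissible C φ L M A s) (γ : Idx C)
    {a b : ℕ} (ha : s ≤ a) (hab : a ≤ b) : ∃ g, IsHat C φ (eSeg C a b γ) g ∧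
      ‖g - φ γ.1.kap • eSeg C a b γ‖ ≤ (if γ.1.rank ≤ a then 0 else γ.1.weight C.W) * A := by
  obtain ⟨g, h1, h2, h3⟩ := hatEstimate h.nonneg_L h.nonneg_A h.one_le h.bound h.lipschitz
    h.norm_le γ.1 γ.2 a b ha hab
  refine ⟨g, h1, ?_⟩
  split_ifs with hr
  · rw [h2 hr, zero_mul]
    exact (dual_norm_sub_self _).le
  · refine (h3 (not_le.1 hr)).trans ?_
    gcongr
    · exact Node.weight_nonneg _ _
    · exact ageBound_le h.nonneg_L h.nonneg_A ha h.bound _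

theorem Admissible.norm_eSeg_hat_le {L M A : ℝ} {s : ℕ} (h : Admissible C φ L M A s) (γ : Idx C)
    {a b : ℕ} (ha : s ≤ a) (hab : a ≤ b) (x : Submodule.span ℂ (Set.range (dVec C))) :
    ‖eSeg C a b γ (hat C φ x)‖ ≤ (A / 8 + 8 / 3 * M) * ‖x‖ := by
  obtain ⟨g, h1, h2⟩ := h.exists_isHat γ ha hab
  rw [← h1.apply_eq x]
  refine (g.le_opNorm x.1).trans ?_
  have h3 : ‖g‖ ≤ ‖g - φ γ.1.kap • eSeg C a b γ‖ + ‖φ γ.1.kap‖ * ‖eSeg C a b γ‖ := by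
    have := dual_norm_sub_smul_le g (eSeg C a b γ) (φ γ.1.kap) 0
    rwa [zero_smul, sub_zero, sub_zero] at this
  have h4 : ‖φ γ.1.kap‖ * ‖eSeg C a b γ‖ ≤ M * (8 / 3) := by
    gcongr
    · exact (norm_nonneg _).trans (h.norm_le γ.1.kap)
    · exact h.norm_le _
    · exact norm_eSeg_le C a b γ
  have h5 : (if γ.1.rank ≤ a then 0 else γ.1.weight C.W) * A ≤ 1 / 8 * A := by
    refine mul_le_mul_of_nonneg_right ?_ h.nonneg_A
    split_ifs
    · norm_num
    · exact γ.2.weight_le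
  have hx : ‖(x : space C)‖ = ‖x‖ := rfl
  rw [hx]
  gcongr
  linarith

/-- With `s = 1` the estimate covers `e_γ^*` itself, because `e_γ^* = e_γ^* ∘ P_{[1, rank γ]}`; the
norm of the space is the supremum over `γ`. -/
theorem Admissible.norm_hat_le {L M A : ℝ} (h : Admissible C φ L M A 1)
    (hM : 0 ≤ M) (x : Submodule.span ℂ (Set.range (dVec C))) : ‖hat C φ x‖ ≤ (A / 8 + 8 / 3 * M) * ‖x‖ := by
  have h0 := h.nonneg_A
  refine lp.norm_le_of_forall_le (by positivity) fun γ => ?_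
  have := h.norm_eSeg_hat_le γ le_rfl γ.2.one_le_rank x
  rwa [eSeg_one C le_rfl] at this

theorem Admissible.norm_hat_sub_proj_le {L M A : ℝ} {s : ℕ} (h : Admissible C φ L M A s)
    (hM : 0 ≤ M) (x : Submodule.span ℂ (Set.range (dVec C))) :
    ‖hat C φ x - proj C (s - 1) (hat C φ x)‖ ≤ (A / 8 + 8 / 3 * M) * ‖x‖ := by
  have h0 := h.nonneg_A
  refine lp.norm_le_of_forall_le (by positivity) fun γ => ?_
  have := h.norm_eSeg_hat_le γ le_rfl (le_max_left s γ.1.rank) x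
  rwa [eSeg, ContinuousLinearMap.comp_sub, eStar_comp_proj_of_le C (le_max_right s _)] at this

/-! ### General intervals, the choice of `N`, and the extension of `φ̂` -/

theorem projOn_Ico_one (C : Choices K) {N : ℕ} (hN : 2 ≤ N) :
    projOn C (Set.Ico 1 N) = proj C (N - 1) := by
  have h1 : Set.Ico 1 N = Set.Icc 1 (N - 1) := by
    ext k
    simp only [Set.mem_Ico, Set.mem_Icc]
    omega
  rw [projOn, h1, if_pos bddAbove_Icc, csSup_Icc (by omega), csInf_Icc (by omega), Nat.sub_self,
    proj_zero, sub_zero]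

/-- An infinite interval may be cut off at any `b ≥ rank γ`, since `e_γ^* ∘ P_b = e_γ^*`. -/
theorem eStar_comp_projOn (C : Choices K) (γ : Idx C) {I : Set ℕ} (hI : I.Nonempty) :
    ∃ b, sInf I ≤ b ∧ eStar C γ ∘L projOn C I = eSeg C (sInf I) b γ := by
  by_cases hb : BddAbove I
  · refine ⟨sSup I, csInf_le_csSup hI (OrderBot.bddBelow I) hb, ?_⟩
    rw [projOn, if_pos hb, eSeg]
  · refine ⟨max (sInf I) γ.1.rank, le_max_left _ _, ?_⟩
    rw [projOn, if_neg hb, eSeg, ContinuousLinearMap.comp_sub, ContinuousLinearMap.comp_sub,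
      eStar_comp_proj_of_le C (le_max_right _ _), ContinuousLinearMap.comp_id]

theorem exists_admissible (C : Choices K) {L M : ℝ} (hL : 0 ≤ L) (hM : 0 ≤ M) :
    ∃ (N : ℕ) (L' A : ℝ), 2 ≤ N ∧ ∀ φ : K → ℂ, (∀ x y, ‖φ x - φ y‖ ≤ L * C.F.metric x y) →
      (∀ x, ‖φ x‖ ≤ M) → Admissible C φ L' M (7 * M) N ∧ Admissible C φ L' M A 1 := by
  -- For `s = 1` the admissibility condition reads `16/3 M + 4L' ≤ 3A/8`; this `A` gives equality.
  have hA : ∀ L' : ℝ, (8 / 3 * (16 / 3 * M + 4 * L')) / 8 + 16 / 3 * M +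
      (8 * L' + 8 / 3 * (16 / 3 * M + 4 * L')) * ((2 : ℝ) ^ 1)⁻¹ ≤
        8 / 3 * (16 / 3 * M + 4 * L') := by
    intro L'
    linarith
  -- If `M = 0`, the constant `7M` leaves no room for `8L · 2^{-N}`; but then `φ = 0`, and `L' = 0`
  -- is a Lipschitz constant.
  rcases hM.eq_or_lt with rfl | hM'
  · refine ⟨2, 0, 8 / 3 * (16 / 3 * 0 + 4 * 0), le_rfl, fun φ hLip hφ => ?_⟩
    have h0 : ∀ x, φ x = 0 := fun x => norm_le_zero_iff.1 (hφ x)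
    have hLip' : ∀ x y, ‖φ x - φ y‖ ≤ 0 * C.F.metric x y := fun x y => by simp [h0]
    exact ⟨⟨le_rfl, by norm_num, one_le_two, by norm_num, hLip', hφ⟩,
      ⟨le_rfl, by norm_num, le_rfl, hA 0, hLip', hφ⟩⟩
  -- The room available is `7M - 7M/8 - 16/3 M = 19/24 M`, which has to absorb `(8L + 7M) 2^{-N}`.
  · obtain ⟨n, hn⟩ := exists_pow_lt_of_lt_one (show 0 < 19 / 24 * M / (8 * L + 7 * M) by positivity)
      (show (1 / 2 : ℝ) < 1 by norm_num)
    refine ⟨n + 2, L, _, by omega, fun φ hLip hφ =>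
      ⟨⟨hL, by positivity, by omega, ?_, hLip, hφ⟩, ⟨hL, by positivity, le_rfl, hA L, hLip, hφ⟩⟩⟩
    rw [lt_div_iff₀ (by positivity)] at hn
    have h1 : ((2 : ℝ) ^ (n + 2))⁻¹ ≤ (1 / 2) ^ n := by
      rw [one_div, inv_pow]
      gcongr
      · norm_num
      · omega
    have h2 := mul_le_mul_of_nonneg_left h1 (show 0 ≤ 8 * L + 7 * M by positivity)
    linarith

theorem opNorm_le_of_dense_span (C : Choices K) {B : ℝ} (hB : 0 ≤ B) (S : space C →L[ℂ] space C)
    (h : ∀ x : Submodule.span ℂ (Set.range (dVec C)), ‖S x‖ ≤ B * ‖x‖) : ‖S‖ ≤ B :=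
  ContinuousLinearMap.opNorm_le_bound _ hB fun x =>
    (denseRange_span_dVec C).induction_on (p := fun x => ‖S x‖ ≤ B * ‖x‖) x
      (isClosed_le S.continuous.norm (continuous_const.mul continuous_norm)) h

/-- Admissibility at `1` only serves to make `φ̂` bounded; the final bound uses the constant `A` at
`N` and is checked on the dense span. -/
theorem Admissible.exists_extension {L M A A' : ℝ} {N : ℕ} (h1 : Admissible C φ L M A' 1)
    (h : Admissible C φ L M A N) (hM : 0 ≤ M) (hN : 2 ≤ N) :
    ∃ T : space C →L[ℂ] space C,
      (∀ x : Submodule.span ℂ (Set.range (dVec C)), T x = hat C φ x) ∧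
      ‖T - projOn C (Set.Ico 1 N) ∘L T‖ ≤ A / 8 + 8 / 3 * M := by
  have : CompleteSpace (space C) :=
    (Submodule.isClosed_topologicalClosure _).completeSpace_coe
  have hT := LinearMap.extendOfNorm_eq (f := hat C φ) (denseRange_span_dVec C)
    ⟨_, h1.norm_hat_le hM⟩
  refine ⟨(hat C φ).extendOfNorm (Submodule.subtype _), hT, ?_⟩
  have h0 := h.nonneg_A
  refine opNorm_le_of_dense_span C (by positivity) _ fun y => ?_
  have hy := h.norm_hat_sub_proj_le hM y
  rw [← hT y] at hy
  rw [projOn_Ico_one C hN]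
  exact hy

end BDCK

end

theorem mainTheorem4 {K : Type*} [MetricSpace K] [CompactSpace K] (C : BDCK.Choices K)
    (L M : ℝ) (hL : 0 ≤ L) (hM : 0 ≤ M) :
    ∃ N : ℕ, 1 ≤ N ∧ ∀ φ : K → ℂ,
      (∀ x y, ‖φ x - φ y‖ ≤ L * C.F.metric x y) → (∀ x, ‖φ x‖ ≤ M) →
      (∀ (γ : BDCK.Idx C) (I : Set ℕ), I.OrdConnected → I.Nonempty → N ≤ sInf I →
        ∃ h : BDCK.eStar C γ ∘L BDCK.projOn C I ∈
            Submodule.span ℂ (Set.range (BDCK.dStar C)),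
          ‖BDCK.hatStar C φ ⟨BDCK.eStar C γ ∘L BDCK.projOn C I, h⟩ -
              φ γ.1.kap • (BDCK.eStar C γ ∘L BDCK.projOn C I)‖ ≤
            7 * γ.1.weightOn C.W I * M) ∧
      ∃ T : BDCK.space C →L[ℂ] BDCK.space C,
        (∀ x : Submodule.span ℂ (Set.range (BDCK.dVec C)), T x = BDCK.hat C φ x) ∧
        ‖T - BDCK.projOn C (Set.Ico 1 N) ∘L T‖ ≤ 4 * M := by
  obtain ⟨N, L', A, hN, hadm⟩ := BDCK.exists_admissible C hL hM
  refine ⟨N, by omega, fun φ hLip hφ => ?_⟩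
  obtain ⟨h7, h1⟩ := hadm φ hLip hφ
  refine ⟨fun γ I _ hI hNI => ?_, ?_⟩
  · obtain ⟨b, hb, he⟩ := BDCK.eStar_comp_projOn C γ hI
    obtain ⟨g, ⟨hg, rfl⟩, hgn⟩ := h7.exists_isHat γ hNI hb
    simp only [he]
    refine ⟨hg, hgn.trans_eq ?_⟩
    rw [BDCK.Node.weightOn]
    ring
  · obtain ⟨T, hT, hTn⟩ := h1.exists_extension h7 hM hN
    -- With `A = 7M` the bound is `7/8 M + 8/3 M = 85/24 M`.
    exact ⟨T, hT, hTn.trans (by linarith)⟩
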